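/- **Setting.** An AMP instance of size $N$ and degree at most $D$ consists of a random symmetric matrix $A\in\mathbb R^{N\times N}$ with zero diagonal whose entries $A_{ij}$ ($i<j$) are independent, centred, with variance $1/N$ and $\log\mathbb E[e^{\lambda A_{ij}}]\le C_0\lambda^2/(2N)$ for all $\lambda$; polynomials $f_0(x)=x$ and $f_1,f_2,\dots$ of degree at most $D$; and an initial vector $x^0$, independent of $A$, with independent entries such that $\mathbb E[(x^0_i)^2]=\tau_0^2$ and $\mathbb E|x_i^0|^p\le (K_0p)^{p/2}$ for all $p\ge1$. The iterates are $$x^{t+1}_i=\sum_{j}A_{ij}f_t(x^t_j)-\sum_jA_{ij}^2f_t'(x^t_j)\,f_{t-1}(x^{t-1}_i),\qquad f_{-1}\equiv0,$$ and state evolution predicts $\mathbb E[(x^t_i)^m]\approx\mathbb E[(y^t)^m]$ with $y^t\sim\mathcal N(0,\tau_t^2)$, where $\tau_{t+1}^2=\mathbb E[f_t(\tau_tZ)^2]$, $Z\sim\mathcal N(0,1)$. If $f_s(z)=c_sz^{d_s}$ for all $s$ (with $f_0(z)=z$), let $T_{t,m}$ be the rooted tree with levels $t,t-1,\dots,0$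 whose root (level $t$) has $m$ children and in which each vertex at level $1\le s\le t-1$ has $d_s$ children; it is the only unlabeled tree in the monomial tree expansion of $(x^t_i)^m$. Its contribution to $\mathbb E[(x_i^t)^m]$ is $$\mathrm{Contr}_i(T_{t,m})=\sum_{\ell}\mathbb E\Big[\prod_{v}c_{s(v)}\prod_{(u,v)}A_{\ell(u)\ell(v)}\prod_{v\text{ leaf}}x^0_{\ell(v)}\Big],$$ where the sum is over all labelings $\ell$ of the vertices by $[N]$ that give the root the label $i$ and are non-backtracking (no vertex has the same label as its grandparent), the first product is over the non-root vertices $v$ with level $s(v)$, and the second is over all edges (parent $u$, child $v$). **Proposition.** Let $A$ have independent Gaussian entries $A_{ij}\sim\mathcal N(0,1/N)$ for $i<j$ (symmetric, zero diagonal), let $x^0=(1,\dots,1)$, and let $$f_0(x)=x,\qquad f_s(x)=\frac{x^D}{\sqrt{(2D-1)!!}}\quad(s\ge1).$$ 1. For all $N$ and all $D\ge1$ this is an AMP instance of degree at most $D$ with $C_0=K_0=\tau_0^2=1$; moreover $\tau_s^2=1$ for all $s$, and all coefficients of all $f_s$ are bounded by $1$ in absolute value. (So all assumptions on the instance hold with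 constants independent of $N$ and $D$.) 2. There are absolute constants $C,c>0$ such that the following holds for every constant $K$. Let $D=D_N\to\infty$ and let $t=t_N\ge3$ be integers with $$C\,\frac{\log N}{D\log D}\le t\le K\,\frac{\log N}{\log D}$$ for all large $N$, and let $m\ge2$ be a fixed even integer. Then, for all large $N$ and all $i\in[N]$, $$\mathrm{Contr}_i(T_{t,m})\ge\exp\!\big(c\,m\,D^{t-1}\,t\log D\big);$$ in particular the contribution of this single tree diverges, uniformly in $i$. Moreover state evolution fails: $$\min_{i\in[N]}\Big|\mathbb E\big[(x^t_i)^m\big]-\mathbb E\big[(y^t)^m\big]\Big|\longrightarrow\infty\qquad(N\to\infty).$$ Hence the moment form of state evolution fails for $C\log N/(D\log D)\le t\lesssim\log N/\log D$, so an iteration bound of order $\log N/(D\log D)$ for its validity cannot be improved by more than a constant factor. -/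

import Mathlib

open MeasureTheory ProbabilityTheory Filter Topology
open scoped Nat NNReal

noncomputable section

namespace AMP

/-! ### AMP iterates and state evolution -/

/-- The AMP iterates
`x^{t+1}_i = ∑_j A_ij f_t(x^t_j) - ∑_j A_ij² f_t'(x^t_j) f_{t-1}(x^{t-1}_i)`,
with the convention `f_{-1} = 0`, so that there is no Onsager term in the first step. -/
def iterate {N : ℕ} (A : Matrix (Fin N) (Fin N) ℝ) (f : ℕ → Polynomial ℝ) (x0 : Fin N → ℝ) :
    ℕ → Fin N → ℝ
  | 0 => x0
  | 1 => fun i => ∑ j, A i j * (f 0).eval (x0 j)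
  | t + 2 => fun i =>
      ∑ j, A i j * (f (t + 1)).eval (iterate A f x0 (t + 1) j)
        - ∑ j, A i j ^ 2 * (f (t + 1)).derivative.eval (iterate A f x0 (t + 1) j)
            * (f t).eval (iterate A f x0 t i)

/-- The state evolution variances `τ_t²`: `τ_0² = v0` and `τ_{t+1}² = E[f_t(τ_t Z)²]`,
where `Z` is standard Gaussian. -/
def seVar (f : ℕ → Polynomial ℝ) (v0 : ℝ) : ℕ → ℝ
  | 0 => v0
  | t + 1 => ∫ z, (f t).eval (√(seVar f v0 t) * z) ^ 2 ∂(gaussianReal 0 1)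

/-- The state evolution prediction `E[y^m]`, `y ∼ N(0, τ_t²)`, for the `m`-th moment of `x_i^t`. -/
def seMoment (f : ℕ → Polynomial ℝ) (v0 : ℝ) (t m : ℕ) : ℝ :=
  ∫ y, y ^ m ∂(gaussianReal 0 (seVar f v0 t).toNNReal)

/-- `(A, f, x0)` is an AMP instance of size `N` and degree at most `D`, with sub-Gaussian
constants `C` (for the matrix) and `K` (for the initialization), and with `E[(x_i^0)²] = v0`. -/
structure IsInstance {Ω : Type*} [MeasurableSpace Ω] (P : Measure Ω) {N : ℕ}
    (A : Ω → Matrix (Fin N) (Fin N) ℝ) (f : ℕ → Polynomial ℝ) (x0 : Ω → Fin N → ℝ)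
    (D : ℕ) (C : ℝ≥0) (K v0 : ℝ) : Prop where
  isProbabilityMeasure : IsProbabilityMeasure P
  symm : ∀ ω, (A ω).IsSymm
  diag : ∀ ω i, A ω i i = 0
  measurable_matrix : ∀ i j, Measurable fun ω => A ω i j
  indep_matrix :
    iIndepFun (fun (p : {p : Fin N × Fin N // p.1 < p.2}) ω => A ω p.1.1 p.1.2) P
  mean : ∀ i j, i ≠ j → ∫ ω, A ω i j ∂P = 0
  variance : ∀ i j, i ≠ j → ∫ ω, A ω i j ^ 2 ∂P = 1 / N
  /-- `log E[exp(λ A_ij)] ≤ C λ² / (2 N)` for all real `λ`. -/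
  subgaussian : ∀ i j, i ≠ j → HasSubgaussianMGF (fun ω => A ω i j) (C / N) P
  degree_le : ∀ s, (f s).natDegree ≤ D
  f_zero : f 0 = Polynomial.X
  measurable_init : ∀ i, Measurable fun ω => x0 ω i
  indep_init : iIndepFun (fun i ω => x0 ω i) P
  indep_init_matrix : IndepFun x0 (fun ω (p : Fin N × Fin N) => A ω p.1 p.2) P
  second_moment_init : ∀ i, ∫ ω, x0 ω i ^ 2 ∂P = v0
  moments_init : ∀ i, ∀ p : ℝ, 1 ≤ p →
    Integrable (fun ω => |x0 ω i| ^ p) P ∧ ∫ ω, |x0 ω i| ^ p ∂P ≤ (K * p) ^ (p / 2)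

/-- Up to the horizon `t`, all state evolution variances and all coefficients of the `f_s` are
bounded by `M`. -/
def UniformlyBounded (f : ℕ → Polynomial ℝ) (v0 : ℝ) (t : ℕ) (M : ℝ) : Prop :=
  ∀ s ≤ t, seVar f v0 s ≤ M ∧ ∀ d, |(f s).coeff d| ≤ M

/-! ### Labeled monomial trees

A rooted tree in which every vertex at depth `r` has `b r` children. A vertex at depth `s` is
encoded by the successive choices of children on the way down from the root. -/

/-- The vertices at depth `s`. -/
abbrev Level (b : ℕ → ℕ) (s : ℕ) : Type := (r : Fin s) → Fin (b r)

/-- The parent of a vertex at depth `s + 1`. -/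
def parent {b : ℕ → ℕ} {s : ℕ} (v : Level b (s + 1)) : Level b s := fun r => v r.castSucc

/-- Labelings by `Fin N` of all vertices of the tree of depth `t`. -/
abbrev Labeling (b : ℕ → ℕ) (t N : ℕ) : Type := (s : Fin (t + 1)) → Level b s → Fin N

/-- The root has label `i` and the labeling is non-backtracking: no vertex has the same label as
its grandparent. -/
def IsAdmissible {b : ℕ → ℕ} {t N : ℕ} (i : Fin N) (lab : Labeling b t N) : Prop :=
  (∀ v, lab 0 v = i) ∧
    ∀ (s : ℕ) (h : s + 2 ≤ t) (v : Level b (s + 2)),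
      lab ⟨s + 2, by omega⟩ v ≠ lab ⟨s, by omega⟩ (parent (parent v))

/-- The value of a labeled tree: the product of the coefficients `coef s` over the non-root
vertices at depth `s`, of the matrix entries over the edges, and of the entries of `x0` over the
leaves (the vertices at depth `t`). -/
def treeVal {b : ℕ → ℕ} {t N : ℕ} (coef : ℕ → ℝ) (A : Matrix (Fin N) (Fin N) ℝ)
    (x0 : Fin N → ℝ) (lab : Labeling b t N) : ℝ :=
  (∏ s : Fin t, ∏ _v : Level b (s + 1), coef (s + 1)) *
    (∏ s : Fin t, ∏ v : Level b (s + 1), A (lab s.castSucc (parent v)) (lab s.succ v)) *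
    ∏ v : Level b t, x0 (lab (Fin.last t) v)

/-- The number of children of the vertices at depth `r` in the monomial tree of depth `t` of
`(x_i^t)^m`, for `f_s(z) = c_s z^{d_s}`: the root has `m` children, and a vertex at depth `r ≥ 1`,
that is, at level `t - r`, has `d_{t-r}` children. -/
def branching (d : ℕ → ℕ) (t m : ℕ) (r : ℕ) : ℕ := if r = 0 then m else d (t - r)

open Classical in
/-- The contribution to `E[(x_i^t)^m]` of the unlabeled monomial tree of depth `t` with `m`
children at the root, for `f_s(z) = c_s z^{d_s}` with `f_0(z) = z`: the sum over all
non-backtracking labelings with root label `i` of the expected value of the labeled tree. -/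
def treeContribution {Ω : Type*} [MeasurableSpace Ω] (P : Measure Ω) {N : ℕ}
    (A : Ω → Matrix (Fin N) (Fin N) ℝ) (c : ℕ → ℝ) (d : ℕ → ℕ) (x0 : Ω → Fin N → ℝ)
    (t m : ℕ) (i : Fin N) : ℝ :=
  ∑ lab : Labeling (branching d t m) t N with IsAdmissible i lab,
    ∫ ω, treeVal (fun r => c (t - r)) (A ω) (x0 ω) lab ∂P

/-! ### The Gaussian monomial instance -/

/-- The law of the entries above the diagonal: independent Gaussians `N(0, 1/N)`. -/
def gaussianLaw (N : ℕ) : Measure ({p : Fin N × Fin N // p.1 < p.2} → ℝ) :=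
  Measure.pi fun _ => gaussianReal 0 (1 / (N : ℝ≥0))

/-- The symmetric matrix with zero diagonal and entries `g` above the diagonal. -/
def symMatrix (N : ℕ) (g : {p : Fin N × Fin N // p.1 < p.2} → ℝ) : Matrix (Fin N) (Fin N) ℝ :=
  Matrix.of fun i j =>
    if h : i < j then g ⟨(i, j), h⟩ else if h : j < i then g ⟨(j, i), h⟩ else 0

/-- The degrees of the monomials: `d_0 = 1` and `d_s = D` for `s ≥ 1`. -/
def monoDeg (D s : ℕ) : ℕ := if s = 0 then 1 else D

/-- The coefficients of the monomials: `c_0 = 1` and `c_s = 1 / √((2D-1)!!)` for `s ≥ 1`. -/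
def monoCoef (D s : ℕ) : ℝ := if s = 0 then 1 else 1 / √((2 * D - 1)‼ : ℝ)

/-- `f_0(x) = x` and `f_s(x) = x^D / √((2D-1)!!)` for `s ≥ 1`. -/
def monoPoly (D s : ℕ) : Polynomial ℝ := Polynomial.monomial (monoDeg D s) (monoCoef D s)

end AMP

end

/-!
State evolution predicts a bounded `m`-th moment for the monomial instance, so both divergence
claims amount to lower bounds on Gaussian moments of homogeneous polynomials of the matrix. Both
come from one principle. Let `F` be a homogeneous polynomial of degree `M` on `ℝ^ι` and `g` a vector
of independent `N(0, v)` variables. For every direction `u ≠ 0`,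
`E[F(g)²] ≥ M! (v / ‖u‖²)^M F(u)²` (`factorial_mul_sq_le_integral_sq_pi_gaussianReal`).
Indeed, conditionally on the part of `g` orthogonal to `u`, the variable `F(g)` is a polynomial of
degree `M` in one Gaussian variable, with the deterministic leading coefficient `F(u)`, and the
second moment is at least that of the component along the `M`-th Hermite polynomial
(`coeff_sq_mul_factorial_le_integral_sq`).

*The iterates.* For `x^0 = 1` the iterate `x_i^t` is homogeneous in the matrix, of degree
`1 + D + ⋯ + D^(t-1)`, because the Onsager term has the same degree as the leading term
(`AMP.hasTopCoeff_iterate`). As direction take a broom: a path with `i` in its middle, which has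
about `N` leaves attached to one of its ends, at distance `t - 1` from `i`. The signs along the path
alternate, so that `x^1` vanishes at the inner vertices. Then the large value of `x^1` at the end
carrying the leaves travels towards `i`, one step per iteration, and meets only zeros
(`AMP.iterate_broom_eq_zero`): the Onsager term vanishes at the front, except in the first step,
where it has a favourable sign. Hence `|x_i^t|` is at least the product of the coefficients and of
the `D^(t-1)`-th power of the number of leaves minus one (`AMP.le_abs_iterate_broom`). This bounds
`E[(x_i^t)²]` from below, and `x² ≤ 1 + x^m` passes the bound on to the `m`-th moment.

*The tree.* All labelings contribute nonnegatively (`AMP.integral_treeVal_nonneg`), so one may keep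
only those which are constant on each level except the leaves, with distinct constants along the
path of the broom and with the leaves labelled freely by leaves of the broom. As `m` is even, their
total contribution is the expectation of the square of a homogeneous polynomial
(`AMP.integral_path_le_treeContribution`), to which the principle applies with the same direction
(`AMP.le_treeContribution`).

*Size.* With `E` of the order of `m D^(t-1)`, the factorial is worth about `exp (E (t - 1) log D)`.
The coefficients `1 / √((2D-1)‼)` cost `exp (E log D)`, and since the squared norm of the broom is of
order `N` the leaves cost only `exp (O(E))`, while each of the `O(E / D)` inner edges costs a power
of `N`. So the bound is large as soon as `t - 2 ≥ t / 3` exceeds a multiple of `log N / (D log D)`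
(`AMP.exp_le_moment_lower_bound`).
-/

noncomputable section

/-! ### Polynomials of one Gaussian variable -/

lemma integrable_polynomial_eval_gaussianReal (p : Polynomial ℝ) (v : ℝ≥0) :
    Integrable (fun x => p.eval x) (gaussianReal 0 v) := by
  induction p using Polynomial.induction_on' with
  | add p q hp hq => exact (hp.add hq).congr (ae_of_all _ fun x => by simp)
  | monomial n a =>
    have h : Integrable (fun x : ℝ => x ^ n) (gaussianReal 0 v) := by
      rcases Nat.eq_zero_or_pos n with rfl | hn
      · simp
      · have := (memLp_id_gaussianReal (μ := 0) (v := v) (n : ℝ≥0)).integrable_norm_pow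
          (p := n) hn.ne'
        refine this.mono' (by fun_prop) (ae_of_all _ fun x => by simp)
    simpa using h.const_mul a

/-- Gaussian integration by parts for polynomials. -/
lemma integral_mul_polynomial_eval_gaussianReal (p : Polynomial ℝ) :
    ∫ x, x * p.eval x ∂(gaussianReal 0 1) = ∫ x, p.derivative.eval x ∂(gaussianReal 0 1) := by
  have hint : ∀ q : Polynomial ℝ, Integrable (fun x => q.eval x * gaussianPDFReal 0 1 x) := by
    intro q
    have h := integrable_polynomial_eval_gaussianReal q 1
    rw [gaussianReal_of_var_ne_zero 0 one_ne_zero,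
      integrable_withDensity_iff (measurable_gaussianPDF 0 1)
        (ae_of_all _ fun x => gaussianPDF_lt_top)] at h
    simpa [toReal_gaussianPDF] using h
  have hder : ∀ x : ℝ, HasDerivAt (gaussianPDFReal 0 1) (-x * gaussianPDFReal 0 1 x) x := by
    intro x
    have h0 : HasDerivAt (fun y : ℝ => y ^ 2) (2 * x) x := by simpa using hasDerivAt_pow 2 x
    have h1 : HasDerivAt (fun y : ℝ => -(y - 0) ^ 2 / (2 * ((1 : ℝ≥0) : ℝ))) (-x) x :=
      ((h0.neg.div_const 2).congr_of_eventuallyEq (Eventually.of_forall fun y => by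
        simp)).congr_deriv (by ring)
    have h2 := (h1.exp).const_mul (√(2 * Real.pi * ((1 : ℝ≥0) : ℝ)))⁻¹
    exact h2.congr_deriv (by rw [gaussianPDFReal_def]; ring)
  have key := integral_mul_deriv_eq_deriv_mul_of_integrable
    (u := fun x => p.eval x) (v := gaussianPDFReal 0 1) (u' := fun x => p.derivative.eval x)
    (v' := fun x => -x * gaussianPDFReal 0 1 x)
    (fun x _ => p.hasDerivAt x) (fun x _ => hder x)
    (by
      refine (hint (-(Polynomial.X * p))).congr (ae_of_all _ fun x => ?_)
      simp; ring)
    (hint _) (hint _)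
  rw [integral_gaussianReal_eq_integral_smul one_ne_zero,
    integral_gaussianReal_eq_integral_smul one_ne_zero]
  simp only [smul_eq_mul]
  calc ∫ x, gaussianPDFReal 0 1 x * (x * p.eval x)
      = -∫ x, p.eval x * (-x * gaussianPDFReal 0 1 x) := by
        rw [← integral_neg]; congr 1; ext x; ring
    _ = ∫ x, p.derivative.eval x * gaussianPDFReal 0 1 x := by rw [key]; ring
    _ = _ := by congr 1; ext x; ring

/-- Rodrigues' formula in weak form: pairing with the `n`-th Hermite polynomial is
the same as taking the expectation of the `n`-th derivative. -/
lemma integral_hermite_mul_gaussianReal (n : ℕ) (p : Polynomial ℝ) :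
    ∫ x, ((Polynomial.hermite n).map (Int.castRingHom ℝ) * p).eval x ∂(gaussianReal 0 1) =
      ∫ x, (Polynomial.derivative^[n] p).eval x ∂(gaussianReal 0 1) := by
  induction n generalizing p with
  | zero => simp
  | succ n ih =>
    set H := (Polynomial.hermite n).map (Int.castRingHom ℝ) with hH
    have e : (Polynomial.hermite (n + 1)).map (Int.castRingHom ℝ) * p =
        Polynomial.X * (H * p) - H.derivative * p := by
      rw [Polynomial.hermite_succ]
      simp only [Polynomial.map_sub, Polynomial.map_mul, Polynomial.map_X,
        ← Polynomial.derivative_map, ← hH]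
      ring
    rw [e, Function.iterate_succ_apply, ← ih]
    have e2 : (fun x => (Polynomial.X * (H * p) - H.derivative * p).eval x) =
        fun x => x * (H * p).eval x - (H.derivative * p).eval x := by
      ext x; simp
    rw [e2, integral_sub, integral_mul_polynomial_eval_gaussianReal, ← integral_sub]
    · congr 1; ext x; simp
    · exact integrable_polynomial_eval_gaussianReal _ 1
    · exact integrable_polynomial_eval_gaussianReal _ 1
    · exact (integrable_polynomial_eval_gaussianReal (Polynomial.X * (H * p)) 1).congr
        (ae_of_all _ fun x => by simp)
    · exact integrable_polynomial_eval_gaussianReal _ 1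

lemma iterate_derivative_eq_C_of_natDegree_le {p : Polynomial ℝ} {M : ℕ} (h : p.natDegree ≤ M) :
    Polynomial.derivative^[M] p = Polynomial.C (M ! * p.coeff M) := by
  ext k
  rw [Polynomial.coeff_iterate_derivative, Polynomial.coeff_C]
  rcases k with _ | k
  · simp [Nat.descFactorial_self]
  · rw [Polynomial.coeff_eq_zero_of_natDegree_lt (by omega)]; simp

/-- A polynomial of degree at most `M` in a Gaussian variable has second moment at least that of
its component along the `M`-th Hermite polynomial. -/
lemma coeff_sq_mul_factorial_le_integral_sq {p : Polynomial ℝ} {M : ℕ} (h : p.natDegree ≤ M)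
    (v : ℝ≥0) :
    p.coeff M ^ 2 * M ! * (v : ℝ) ^ M ≤ ∫ x, p.eval x ^ 2 ∂(gaussianReal 0 v) := by
  -- the standard case
  have std : ∀ q : Polynomial ℝ, q.natDegree ≤ M →
      q.coeff M ^ 2 * M ! ≤ ∫ x, q.eval x ^ 2 ∂(gaussianReal 0 1) := by
    intro q hq
    set H := (Polynomial.hermite M).map (Int.castRingHom ℝ) with hH
    have hHdeg : H.natDegree ≤ M :=
      Polynomial.natDegree_map_le.trans Polynomial.natDegree_hermite.le
    have hHc : H.coeff M = 1 := by simp [hH]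
    have pair : ∀ r : Polynomial ℝ, r.natDegree ≤ M →
        ∫ x, (H * r).eval x ∂(gaussianReal 0 1) = M ! * r.coeff M := by
      intro r hr
      rw [integral_hermite_mul_gaussianReal, iterate_derivative_eq_C_of_natDegree_le hr]
      simp
    have h0 : 0 ≤ ∫ x, (q - Polynomial.C (q.coeff M) * H).eval x ^ 2 ∂(gaussianReal 0 1) :=
      integral_nonneg fun x => sq_nonneg _
    have e : ∀ x, (q - Polynomial.C (q.coeff M) * H).eval x ^ 2 =
        q.eval x ^ 2 - (2 * q.coeff M * (H * q).eval x - q.coeff M ^ 2 * (H * H).eval x) := by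
      intro x; simp; ring
    have i1 := integrable_polynomial_eval_gaussianReal (H * q) 1
    have i2 := integrable_polynomial_eval_gaussianReal (H * H) 1
    have i3 : Integrable (fun x => q.eval x ^ 2) (gaussianReal 0 1) :=
      (integrable_polynomial_eval_gaussianReal (q ^ 2) 1).congr (ae_of_all _ fun x => by simp)
    simp_rw [e] at h0
    have j1 := i1.const_mul (2 * q.coeff M)
    have j2 := i2.const_mul (q.coeff M ^ 2)
    rw [integral_sub i3 (g := fun x => 2 * q.coeff M * (H * q).eval x -
        q.coeff M ^ 2 * (H * H).eval x) (j1.sub j2),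
      integral_sub j1 j2, integral_const_mul, integral_const_mul,
      pair q hq, pair H hHdeg, hHc] at h0
    nlinarith
  -- scaling
  have hmap : gaussianReal 0 v = (gaussianReal 0 1).map (fun x => √(v : ℝ) * x) := by
    rw [gaussianReal_map_const_mul]
    congr 1
    · simp
    · ext; simp
  have e := std (p.comp (Polynomial.C (√(v : ℝ)) * Polynomial.X)) (by
    refine Polynomial.natDegree_comp_le.trans ?_
    refine (Nat.mul_le_mul h (Polynomial.natDegree_C_mul_le _ _)).trans (by simp))
  rw [Polynomial.comp_C_mul_X_coeff, mul_pow, ← pow_mul, mul_comm M 2, pow_mul,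
    Real.sq_sqrt v.coe_nonneg] at e
  rw [hmap, integral_map (by fun_prop) (by fun_prop)]
  simp only [Polynomial.eval_comp, Polynomial.eval_mul, Polynomial.eval_C,
    Polynomial.eval_X] at e
  linarith

/-- The even moments of a standard Gaussian variable. -/
lemma integral_pow_two_mul_gaussianReal (k : ℕ) :
    ∫ x, x ^ (2 * k) ∂(gaussianReal 0 1) = ((2 * k - 1)‼ : ℝ) := by
  induction k with
  | zero => simp
  | succ k ih =>
    have h := integral_mul_polynomial_eval_gaussianReal (Polynomial.X ^ (2 * k + 1))
    simp only [Polynomial.eval_pow, Polynomial.eval_X, Polynomial.derivative_X_pow,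
      Polynomial.eval_mul, Polynomial.eval_C, add_tsub_cancel_right, integral_const_mul, ih] at h
    have e : ∀ x : ℝ, x ^ (2 * (k + 1)) = x * x ^ (2 * k + 1) := fun x => by ring
    simp_rw [e]
    rw [h, show 2 * (k + 1) - 1 = 2 * k + 1 by omega]
    rcases k with _ | k
    · simp
    · rw [show 2 * (k + 1) + 1 = (2 * k + 1) + 2 by ring, Nat.doubleFactorial_add_two,
        show 2 * (k + 1) - 1 = 2 * k + 1 by omega]
      push_cast; ring

/-- All moments of a centred Gaussian variable are nonnegative. -/
lemma integral_pow_gaussianReal_nonneg (n : ℕ) (v : ℝ≥0) :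
    0 ≤ ∫ x, x ^ n ∂(gaussianReal 0 v) := by
  rcases Nat.even_or_odd n with hn | hn
  · exact integral_nonneg fun x => hn.pow_nonneg x
  · have hmap : (gaussianReal 0 v).map (fun x => -x) = gaussianReal 0 v := by
      rw [gaussianReal_map_neg]; simp
    have : ∫ x, x ^ n ∂(gaussianReal 0 v) = -∫ x, x ^ n ∂(gaussianReal 0 v) := by
      conv_lhs => rw [← hmap, integral_map (by fun_prop) (by fun_prop)]
      simp_rw [hn.neg_pow]
      rw [integral_neg]
    linarith

/-! ### Homogeneous polynomials of a Gaussian vector -/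

/-- If `g` is a vector of independent `N(0, v)` variables and `ξ ∼ N(0, w)` is independent of it,
with `w ‖u‖² = v`, then replacing the component of `g` along `u` by `ξ u` does not change the law
of `g`. -/
lemma map_resample_direction_pi_gaussianReal {ι : Type*} [Fintype ι] (v w : ℝ≥0) (u : ι → ℝ)
    (hu : 0 < ∑ k, u k ^ 2) (hw : (w : ℝ) * ∑ k, u k ^ 2 = v) :
    ((gaussianReal 0 w).prod (Measure.pi fun _ : ι => gaussianReal 0 v)).map
      (fun z => fun k => z.1 * u k + (z.2 k - (∑ l, u l * z.2 l) / (∑ l, u l ^ 2) * u k)) =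
    Measure.pi fun _ : ι => gaussianReal 0 v := by
  have : IsProbabilityMeasure
      (((gaussianReal 0 w).prod (Measure.pi fun _ : ι => gaussianReal 0 v)).map
      (fun z => fun k => z.1 * u k + (z.2 k - (∑ l, u l * z.2 l) / (∑ l, u l ^ 2) * u k))) :=
    Measure.isProbabilityMeasure_map (by fun_prop)
  refine charFun_eq_pi_iff.1 fun t => ?_
  set R := ∑ l, u l ^ 2 with hR
  set a : ℝ := ∑ k, u k * t k with ha
  set s : ι → ℝ := fun k => t k - a / R * u k with hs
  have hinner : ∀ z : ℝ × (ι → ℝ),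
      inner ℝ (WithLp.toLp 2 (fun k => z.1 * u k + (z.2 k - (∑ l, u l * z.2 l) / R * u k))) t =
        z.1 * a + ∑ k, z.2 k * s k := by
    intro z
    simp only [PiLp.inner_apply, RCLike.inner_apply, conj_trivial, hs, ha]
    simp only [mul_add, mul_sub, Finset.sum_add_distrib, Finset.sum_sub_distrib]
    have e1 : ∑ x, t x * (z.1 * u x) = z.1 * ∑ k, u k * t k := by
      rw [Finset.mul_sum]; exact Finset.sum_congr rfl fun k _ => by ring
    have e2 : ∑ x, t x * ((∑ l, u l * z.2 l) / R * u x) =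
        (∑ l, u l * z.2 l) / R * ∑ k, u k * t k := by
      rw [Finset.mul_sum]; exact Finset.sum_congr rfl fun k _ => by ring
    have e3 : ∑ x, z.2 x * ((∑ k, u k * t k) / R * u x) =
        (∑ k, u k * t k) / R * ∑ l, u l * z.2 l := by
      rw [Finset.mul_sum (a := (∑ k, u k * t k) / R)]
      exact Finset.sum_congr rfl fun k _ => by ring
    rw [e1, e2, e3, Finset.sum_congr rfl fun k _ => mul_comm (t k) (z.2 k)]
    ring
  have hnorm : w * a ^ 2 + v * ∑ k, s k ^ 2 = v * ∑ k, t k ^ 2 := by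
    have e : ∑ k, s k ^ 2 = ∑ k, t k ^ 2 - a ^ 2 / R := by
      have : ∀ k, s k ^ 2 = t k ^ 2 - 2 * (a / R) * (u k * t k) + (a / R) ^ 2 * u k ^ 2 := by
        intro k; simp only [hs]; ring
      simp_rw [this]
      rw [Finset.sum_add_distrib, Finset.sum_sub_distrib, ← Finset.mul_sum, ← Finset.mul_sum,
        ← hR, ← ha]
      field_simp; ring
    rw [e, ← hw]; field_simp; ring
  rw [charFun_apply, integral_map (by fun_prop) (by fun_prop),
    integral_map (by fun_prop) (by fun_prop)]
  simp_rw [hinner, Complex.ofReal_add, add_mul, Complex.exp_add]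
  rw [integral_prod_mul (fun x : ℝ => Complex.exp (((x * a : ℝ) : ℂ) * Complex.I))
    (fun g : ι → ℝ => Complex.exp (((∑ k, g k * s k : ℝ) : ℂ) * Complex.I))]
  have h1 : ∀ (c : ℝ) (q : ℝ≥0),
      ∫ x, Complex.exp (((x * c : ℝ) : ℂ) * Complex.I) ∂(gaussianReal 0 q) =
        Complex.exp (-((q * c ^ 2 / 2 : ℝ) : ℂ)) := by
    intro c q
    have := charFun_gaussianReal (μ := 0) (v := q) c
    rw [charFun_apply_real] at this
    simp_rw [Complex.ofReal_mul, mul_comm ((_ : ℝ) : ℂ) (c : ℂ)]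
    rw [this]
    congr 1
    push_cast; ring
  simp_rw [Complex.ofReal_sum, Finset.sum_mul, Complex.exp_sum]
  rw [integral_fintype_prod_eq_prod
    (f := fun k x => Complex.exp (((x * s k : ℝ) : ℂ) * Complex.I))]
  simp_rw [h1, charFun_gaussianReal]
  rw [← Complex.exp_sum, ← Complex.exp_sum, ← Complex.exp_add]
  congr 1
  have h2 : w * a ^ 2 / 2 + ∑ k, v * s k ^ 2 / 2 = ∑ k, v * t k ^ 2 / 2 := by
    rw [← Finset.sum_div, ← Finset.sum_div, ← Finset.mul_sum, ← Finset.mul_sum, ← hnorm]; ring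
  rw [Finset.sum_neg_distrib, ← neg_add, ← Complex.ofReal_sum, ← Complex.ofReal_add, h2]
  push_cast
  rw [← Finset.sum_neg_distrib]
  exact Finset.sum_congr rfl fun k _ => by simp

/-- Suppose that along every line of direction `u` the function `F` is a polynomial of degree at
most `M` whose coefficient of order `M` is `a`, for instance because `F` is a homogeneous
polynomial of degree `M` and `F u = a`. Then `E[F(g)²] ≥ M! (v / ‖u‖²)^M a²` for a vector `g` of
independent `N(0, v)` variables: conditionally on the part of `g` orthogonal to `u`, this is the
one-variable bound. -/
lemma factorial_mul_sq_le_integral_sq_pi_gaussianReal {ι : Type*} [Fintype ι] (v : ℝ≥0)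
    (u : ι → ℝ) {R : ℝ} (hu : 0 < ∑ k, u k ^ 2) (hR : ∑ k, u k ^ 2 ≤ R) {F : (ι → ℝ) → ℝ}
    {M : ℕ} {a : ℝ}
    (hF : ∀ g : ι → ℝ, ∃ p : Polynomial ℝ, p.natDegree ≤ M ∧ p.coeff M = a ∧
      ∀ ξ : ℝ, F (fun k => ξ * u k + g k) = p.eval ξ)
    (hint : Integrable (fun g => F g ^ 2) (Measure.pi fun _ : ι => gaussianReal 0 v)) :
    a ^ 2 * M ! * (v / R) ^ M ≤ ∫ g, F g ^ 2 ∂(Measure.pi fun _ : ι => gaussianReal 0 v) := by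
  set r : ℝ := ∑ k, u k ^ 2 with hr
  set w : ℝ≥0 := (v / r : ℝ).toNNReal with hw
  have hw' : (w : ℝ) = v / r := Real.coe_toNNReal _ (by positivity)
  have hlaw := map_resample_direction_pi_gaussianReal v w u hu (by
    rw [← hr, hw']; field_simp)
  set μ := Measure.pi fun _ : ι => gaussianReal 0 v with hμ
  have hmeas : Measurable (fun z : ℝ × (ι → ℝ) => fun k =>
      z.1 * u k + (z.2 k - (∑ l, u l * z.2 l) / (∑ l, u l ^ 2) * u k)) := by fun_prop
  have hint' : Integrable (fun z : ℝ × (ι → ℝ) => F (fun k =>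
      z.1 * u k + (z.2 k - (∑ l, u l * z.2 l) / (∑ l, u l ^ 2) * u k)) ^ 2)
      ((gaussianReal 0 w).prod μ) := by
    rw [← hlaw] at hint
    exact (integrable_map_measure hint.1 hmeas.aemeasurable).1 hint
  rw [← hlaw, integral_map hmeas.aemeasurable (by rw [hlaw]; exact hint.1)]
  rw [integral_prod_symm _ hint']
  have hle : ∀ g : ι → ℝ, a ^ 2 * M ! * (v / R) ^ M ≤
      ∫ ξ, F (fun k => ξ * u k + (g k - (∑ l, u l * g l) / (∑ l, u l ^ 2) * u k)) ^ 2
        ∂(gaussianReal 0 w) := by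
    intro g
    obtain ⟨p, hp, hpa, hpe⟩ := hF fun k => g k - (∑ l, u l * g l) / (∑ l, u l ^ 2) * u k
    simp_rw [hpe]
    refine le_trans ?_ (coeff_sq_mul_factorial_le_integral_sq hp w)
    have hR0 : 0 ≤ R := hu.le.trans hR
    rw [hpa, hw']
    gcongr
  calc a ^ 2 * M ! * (v / R) ^ M = ∫ _g, a ^ 2 * M ! * (v / R) ^ M ∂μ := by simp
    _ ≤ _ := integral_mono (integrable_const _) hint'.integral_prod_right hle

/-- The function `f` has finite moments of all orders. Natural orders suffice, and this class is
closed under sums and products. -/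
def HasAllMoments {Ω : Type*} [MeasurableSpace Ω] (P : Measure Ω) (f : Ω → ℝ) : Prop :=
  ∀ p : ℕ, MemLp f p P

namespace HasAllMoments

variable {Ω : Type*} [MeasurableSpace Ω] {P : Measure Ω} {f g : Ω → ℝ}

lemma const [IsFiniteMeasure P] (c : ℝ) : HasAllMoments P fun _ => c := fun _ => memLp_const c

lemma add (hf : HasAllMoments P f) (hg : HasAllMoments P g) :
    HasAllMoments P fun ω => f ω + g ω := fun p => (hf p).add (hg p)

lemma sub (hf : HasAllMoments P f) (hg : HasAllMoments P g) :
    HasAllMoments P fun ω => f ω - g ω := fun p => (hf p).sub (hg p)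

lemma mul (hf : HasAllMoments P f) (hg : HasAllMoments P g) :
    HasAllMoments P fun ω => f ω * g ω := by
  intro p
  have : ENNReal.HolderTriple ((2 * p : ℕ) : ENNReal) ((2 * p : ℕ) : ENNReal) (p : ENNReal) := by
    constructor
    push_cast
    rw [ENNReal.mul_inv (by simp) (by simp), ← two_mul, ← mul_assoc,
      ENNReal.mul_inv_cancel (by simp) (by simp), one_mul]
  exact MemLp.mul' (p := ((2 * p : ℕ) : ENNReal)) (q := ((2 * p : ℕ) : ENNReal))
    (hg (2 * p)) (hf (2 * p))

lemma pow [IsFiniteMeasure P] (hf : HasAllMoments P f) (n : ℕ) :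
    HasAllMoments P fun ω => f ω ^ n := by
  induction n with
  | zero => simpa using const 1
  | succ n ih => simpa [pow_succ] using ih.mul hf

lemma sum [IsFiniteMeasure P] {κ : Type*} (s : Finset κ) {F : κ → Ω → ℝ}
    (hF : ∀ k ∈ s, HasAllMoments P (F k)) : HasAllMoments P fun ω => ∑ k ∈ s, F k ω := by
  classical
  induction s using Finset.induction_on with
  | empty => simpa using const 0
  | insert k s hk ih =>
    simp_rw [Finset.sum_insert hk]
    exact (hF k (by simp)).add (ih fun l hl => hF l (by simp [hl]))

lemma prod [IsFiniteMeasure P] {κ : Type*} (s : Finset κ) {F : κ → Ω → ℝ}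
    (hF : ∀ k ∈ s, HasAllMoments P (F k)) : HasAllMoments P fun ω => ∏ k ∈ s, F k ω := by
  classical
  induction s using Finset.induction_on with
  | empty => simpa using const 1
  | insert k s hk ih =>
    simp_rw [Finset.prod_insert hk]
    exact (hF k (by simp)).mul (ih fun l hl => hF l (by simp [hl]))

lemma polynomial_eval [IsFiniteMeasure P] (hf : HasAllMoments P f) (q : Polynomial ℝ) :
    HasAllMoments P fun ω => q.eval (f ω) := by
  simp_rw [Polynomial.eval_eq_sum_range]
  exact sum _ fun k _ => (const _).mul (hf.pow k)

lemma integrable (hf : HasAllMoments P f) : Integrable f P :=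
  memLp_one_iff_integrable.1 (by simpa using hf 1)

end HasAllMoments

lemma hasAllMoments_eval_pi_gaussianReal {ι : Type*} [Fintype ι] (v : ℝ≥0) (k : ι) :
    HasAllMoments (Measure.pi fun _ : ι => gaussianReal 0 v) fun g => g k := by
  intro p
  have h := memLp_id_gaussianReal' (μ := 0) (v := v) (p : ENNReal) (by simp)
  exact h.comp_measurePreserving (measurePreserving_eval (fun _ : ι => gaussianReal 0 v) k)

namespace AMP

/-! ### The Gaussian monomial instance -/

instance (N : ℕ) : IsProbabilityMeasure (gaussianLaw N) := by
  unfold gaussianLaw; infer_instance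

lemma symMatrix_isSymm (N : ℕ) (g : {p : Fin N × Fin N // p.1 < p.2} → ℝ) :
    (symMatrix N g).IsSymm := by
  ext i j
  simp only [Matrix.transpose_apply, symMatrix, Matrix.of_apply]
  rcases lt_trichotomy i j with h | rfl | h
  · simp [h, h.not_gt]
  · simp
  · simp [h, h.not_gt]

lemma symMatrix_diag (N : ℕ) (g : {p : Fin N × Fin N // p.1 < p.2} → ℝ) (i : Fin N) :
    symMatrix N g i i = 0 := by
  simp [symMatrix]

/-- Every off-diagonal entry is one of the coordinates. -/
lemma exists_symMatrix_apply_eq {N : ℕ} {i j : Fin N} (h : i ≠ j) :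
    ∃ e : {p : Fin N × Fin N // p.1 < p.2}, ∀ g, symMatrix N g i j = g e := by
  rcases lt_or_gt_of_ne h with h | h
  · exact ⟨⟨(i, j), h⟩, fun g => by simp [symMatrix, h]⟩
  · exact ⟨⟨(j, i), h⟩, fun g => by simp [symMatrix, h, h.not_gt]⟩

lemma measurable_symMatrix_apply {N : ℕ} (i j : Fin N) :
    Measurable fun g => symMatrix N g i j := by
  by_cases h : i = j
  · subst h; simp [symMatrix_diag]
  · obtain ⟨e, he⟩ := exists_symMatrix_apply_eq h
    simp_rw [he]; fun_prop

lemma hasAllMoments_symMatrix_apply {N : ℕ} (i j : Fin N) :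
    HasAllMoments (gaussianLaw N) fun g => symMatrix N g i j := by
  by_cases h : i = j
  · subst h; simpa [symMatrix_diag] using HasAllMoments.const 0
  · obtain ⟨e, he⟩ := exists_symMatrix_apply_eq h
    simp_rw [he]; exact hasAllMoments_eval_pi_gaussianReal _ e

lemma integral_comp_eval_gaussianLaw {N : ℕ} (e : {p : Fin N × Fin N // p.1 < p.2}) {f : ℝ → ℝ}
    (hf : Measurable f) :
    ∫ g, f (g e) ∂(gaussianLaw N) = ∫ x, f x ∂(gaussianReal 0 (1 / (N : ℝ≥0))) := by
  rw [gaussianLaw, integral_comp_eval (μ := fun _ => gaussianReal 0 (1 / (N : ℝ≥0)))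
    hf.aestronglyMeasurable]

lemma integral_sq_gaussianReal (v : ℝ≥0) : ∫ x, x ^ 2 ∂(gaussianReal 0 v) = v := by
  have h := variance_id_gaussianReal (μ := 0) (v := v)
  rw [variance_eq_sub (memLp_id_gaussianReal 2)] at h
  simpa using h

lemma iIndepFun_const_apply {Ω ι : Type*} [MeasurableSpace Ω] (P : Measure Ω)
    [IsProbabilityMeasure P] (c : ι → ℝ) : iIndepFun (fun i (_ : Ω) => c i) P := by
  rw [iIndepFun_iff_measure_inter_preimage_eq_mul]
  intro S s _
  by_cases h : ∀ i ∈ S, c i ∈ s i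
  · rw [Finset.prod_congr rfl (fun i hi => by rw [Set.preimage_const_of_mem (h i hi)]),
      Set.iInter₂_congr (fun i hi => Set.preimage_const_of_mem (h i hi))]
    simp
  · push Not at h
    obtain ⟨i, hi, hc⟩ := h
    rw [Finset.prod_eq_zero hi (by rw [Set.preimage_const_of_notMem hc, measure_empty])]
    refine measure_mono_null (Set.iInter₂_subset i hi) ?_
    rw [Set.preimage_const_of_notMem hc, measure_empty]

lemma doubleFactorial_pos_real (n : ℕ) : (0 : ℝ) < (n‼ : ℝ) := by
  exact_mod_cast Nat.doubleFactorial_pos n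

lemma monoCoef_pos (D s : ℕ) : 0 < monoCoef D s := by
  unfold monoCoef
  split_ifs
  · exact one_pos
  · have := doubleFactorial_pos_real (2 * D - 1)
    positivity

lemma monoCoef_le_one (D s : ℕ) : monoCoef D s ≤ 1 := by
  unfold monoCoef
  split_ifs
  · exact le_rfl
  · have h1 : (1 : ℝ) ≤ ((2 * D - 1)‼ : ℝ) := by
      exact_mod_cast Nat.doubleFactorial_pos (2 * D - 1)
    rw [div_le_one (Real.sqrt_pos.2 (by linarith))]
    exact Real.one_le_sqrt.2 h1

lemma monoPoly_eval (D s : ℕ) (x : ℝ) :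
    (monoPoly D s).eval x = monoCoef D s * x ^ monoDeg D s := by
  simp [monoPoly]

theorem isInstance_gaussian (N : ℕ) {D : ℕ} (hD : 1 ≤ D) :
    IsInstance (gaussianLaw N) (symMatrix N) (monoPoly D) (fun _ _ => 1) D 1 1 1 where
  isProbabilityMeasure := inferInstance
  symm := symMatrix_isSymm N
  diag := symMatrix_diag N
  measurable_matrix := measurable_symMatrix_apply
  indep_matrix := by
    have h := iIndepFun_pi (μ := fun _ : {p : Fin N × Fin N // p.1 < p.2} =>
      gaussianReal 0 (1 / (N : ℝ≥0))) (X := fun _ x => x) (fun _ => aemeasurable_id')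
    have e : (fun (p : {p : Fin N × Fin N // p.1 < p.2}) ω => symMatrix N ω p.1.1 p.1.2) =
        fun p ω => ω p := by
      ext p ω; simp [symMatrix, p.2]
    rw [e]; exact h
  mean i j h := by
    obtain ⟨e, he⟩ := exists_symMatrix_apply_eq h
    simp_rw [he]
    rw [integral_comp_eval_gaussianLaw e measurable_id']
    exact integral_id_gaussianReal
  variance i j h := by
    obtain ⟨e, he⟩ := exists_symMatrix_apply_eq h
    simp_rw [he]
    rw [integral_comp_eval_gaussianLaw e (f := fun x => x ^ 2) (by fun_prop),
      integral_sq_gaussianReal]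
    simp
  subgaussian i j h := by
    obtain ⟨e, he⟩ := exists_symMatrix_apply_eq h
    have hmap : (gaussianLaw N).map (fun g => g e) = gaussianReal 0 (1 / (N : ℝ≥0)) :=
      (measurePreserving_eval (fun _ => gaussianReal 0 (1 / (N : ℝ≥0))) e).map_eq
    simp_rw [he]
    constructor
    · intro t
      have := integrable_exp_mul_gaussianReal (μ := 0) (v := 1 / (N : ℝ≥0)) t
      rw [← hmap] at this
      exact this.comp_measurable (by fun_prop)
    · intro t
      rw [mgf_gaussianReal hmap]
      simp
  degree_le s := by
    refine (Polynomial.natDegree_monomial_le _).trans ?_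
    unfold monoDeg; split_ifs <;> omega
  f_zero := by simp [monoPoly, monoDeg, monoCoef, Polynomial.monomial_one_one_eq_X]
  measurable_init _ := measurable_const
  indep_init := iIndepFun_const_apply _ _
  indep_init_matrix := indepFun_const_left _ _
  second_moment_init _ := by simp
  moments_init _ p hp := by
    refine ⟨by simp, ?_⟩
    simpa using Real.one_le_rpow hp (by positivity)

theorem seVar_monoPoly (D s : ℕ) : seVar (monoPoly D) 1 s = 1 := by
  induction s with
  | zero => rfl
  | succ s ih =>
    rw [seVar, ih]
    simp_rw [monoPoly_eval, mul_pow, ← pow_mul]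
    rw [integral_const_mul]
    simp only [Real.sqrt_one, one_pow, one_mul]
    rw [mul_comm _ 2, integral_pow_two_mul_gaussianReal]
    rcases Nat.eq_zero_or_pos s with rfl | hs
    · simp [monoCoef, monoDeg]
    · have := doubleFactorial_pos_real (2 * D - 1)
      simp only [monoCoef, monoDeg, hs.ne', if_false]
      rw [div_pow, Real.sq_sqrt this.le]
      field_simp

theorem uniformlyBounded_monoPoly (D t : ℕ) :
    UniformlyBounded (monoPoly D) 1 t 1 := by
  intro s _
  refine ⟨(seVar_monoPoly D s).le, fun d => ?_⟩
  rw [monoPoly, Polynomial.coeff_monomial]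
  split_ifs
  · rw [abs_of_pos (monoCoef_pos D s)]; exact monoCoef_le_one D s
  · simp

end AMP

/-! ### Homogeneity of the iterates -/

/-- The function `f` is a polynomial of degree at most `M` whose coefficient of order `M`
is `a`. -/
def HasTopCoeff (f : ℝ → ℝ) (M : ℕ) (a : ℝ) : Prop :=
  ∃ p : Polynomial ℝ, p.natDegree ≤ M ∧ p.coeff M = a ∧ ∀ ξ, f ξ = p.eval ξ

namespace HasTopCoeff

variable {f g : ℝ → ℝ} {M M' : ℕ} {a b : ℝ}

lemma const (c : ℝ) : HasTopCoeff (fun _ => c) 0 c :=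
  ⟨Polynomial.C c, by simp, by simp, by simp⟩

lemma linear (a b : ℝ) : HasTopCoeff (fun ξ => ξ * a + b) 1 a :=
  ⟨Polynomial.C a * Polynomial.X + Polynomial.C b, Polynomial.natDegree_linear_le,
    by simp, fun ξ => by simp; ring⟩

lemma add (hf : HasTopCoeff f M a) (hg : HasTopCoeff g M b) :
    HasTopCoeff (fun ξ => f ξ + g ξ) M (a + b) := by
  obtain ⟨p, hp, hpa, hpe⟩ := hf
  obtain ⟨q, hq, hqb, hqe⟩ := hg
  exact ⟨p + q, Polynomial.natDegree_add_le_of_degree_le hp hq, by simp [hpa, hqb],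
    fun ξ => by simp [hpe, hqe]⟩

lemma sub (hf : HasTopCoeff f M a) (hg : HasTopCoeff g M b) :
    HasTopCoeff (fun ξ => f ξ - g ξ) M (a - b) := by
  obtain ⟨p, hp, hpa, hpe⟩ := hf
  obtain ⟨q, hq, hqb, hqe⟩ := hg
  exact ⟨p - q, (Polynomial.natDegree_sub_le_of_le hp hq).trans (max_self M).le, by simp [hpa, hqb],
    fun ξ => by simp [hpe, hqe]⟩

lemma mul (hf : HasTopCoeff f M a) (hg : HasTopCoeff g M' b) :
    HasTopCoeff (fun ξ => f ξ * g ξ) (M + M') (a * b) := by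
  obtain ⟨p, hp, hpa, hpe⟩ := hf
  obtain ⟨q, hq, hqb, hqe⟩ := hg
  exact ⟨p * q, Polynomial.natDegree_mul_le_of_le hp hq,
    by rw [Polynomial.coeff_mul_add_eq_of_natDegree_le hp hq, hpa, hqb],
    fun ξ => by simp [hpe, hqe]⟩

lemma const_mul (c : ℝ) (hf : HasTopCoeff f M a) : HasTopCoeff (fun ξ => c * f ξ) M (c * a) := by
  simpa using (const c).mul hf

lemma pow (hf : HasTopCoeff f M a) (n : ℕ) : HasTopCoeff (fun ξ => f ξ ^ n) (n * M) (a ^ n) := by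
  induction n with
  | zero => simpa using const 1
  | succ n ih => simpa [pow_succ, Nat.succ_mul] using ih.mul hf

lemma sum {κ : Type*} (s : Finset κ) {F : κ → ℝ → ℝ} {A : κ → ℝ}
    (hF : ∀ k ∈ s, HasTopCoeff (F k) M (A k)) :
    HasTopCoeff (fun ξ => ∑ k ∈ s, F k ξ) M (∑ k ∈ s, A k) := by
  classical
  induction s using Finset.induction_on with
  | empty => exact ⟨0, by simp, by simp, by simp⟩
  | insert k s hk ih =>
    simp_rw [Finset.sum_insert hk]
    exact (hF k (by simp)).add (ih fun l hl => hF l (by simp [hl]))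

lemma prod {κ : Type*} (s : Finset κ) {F : κ → ℝ → ℝ} {N : κ → ℕ} {A : κ → ℝ}
    (hF : ∀ k ∈ s, HasTopCoeff (F k) (N k) (A k)) :
    HasTopCoeff (fun ξ => ∏ k ∈ s, F k ξ) (∑ k ∈ s, N k) (∏ k ∈ s, A k) := by
  classical
  induction s using Finset.induction_on with
  | empty => simpa using const 1
  | insert k s hk ih =>
    simp_rw [Finset.prod_insert hk, Finset.sum_insert hk]
    exact (hF k (by simp)).mul (ih fun l hl => hF l (by simp [hl]))

end HasTopCoeff

namespace AMP

lemma monoPoly_derivative_eval (D s : ℕ) (x : ℝ) :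
    (monoPoly D (s + 1)).derivative.eval x = monoCoef D (s + 1) * (D * x ^ (D - 1)) := by
  simp [monoPoly, Polynomial.derivative_monomial, monoDeg, mul_assoc]

lemma sum_range_pow_succ (D t : ℕ) :
    ∑ k ∈ Finset.range (t + 1), D ^ k = 1 + D * ∑ k ∈ Finset.range t, D ^ k := by
  rw [Finset.sum_range_succ', Finset.mul_sum, add_comm]
  simp [pow_succ, mul_comm]

/-- For constant initialization the iterate `x^t` is homogeneous in the matrix, of degree
`1 + D + ⋯ + D^(t-1)`: the Onsager term has the same degree as the leading term. -/
lemma hasTopCoeff_iterate {N D : ℕ} (hD : 1 ≤ D) (U G : Matrix (Fin N) (Fin N) ℝ) (t : ℕ)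
    (i : Fin N) :
    HasTopCoeff (fun ξ => iterate (ξ • U + G) (monoPoly D) (fun _ => 1) t i)
      (∑ k ∈ Finset.range t, D ^ k) (iterate U (monoPoly D) (fun _ => 1) t i) := by
  have hA : ∀ i j, HasTopCoeff (fun ξ => (ξ • U + G) i j) 1 (U i j) := fun i j => by
    simpa using HasTopCoeff.linear (U i j) (G i j)
  suffices h : ∀ t, (∀ i, HasTopCoeff (fun ξ => iterate (ξ • U + G) (monoPoly D) (fun _ => 1) t i)
      (∑ k ∈ Finset.range t, D ^ k) (iterate U (monoPoly D) (fun _ => 1) t i)) ∧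
      ∀ i, HasTopCoeff (fun ξ => iterate (ξ • U + G) (monoPoly D) (fun _ => 1) (t + 1) i)
      (∑ k ∈ Finset.range (t + 1), D ^ k) (iterate U (monoPoly D) (fun _ => 1) (t + 1) i) from
    (h t).1 i
  intro t
  induction t with
  | zero =>
    refine ⟨fun i => by simpa [iterate] using HasTopCoeff.const 1, fun i => ?_⟩
    simp only [iterate, monoPoly_eval, one_pow, mul_one, zero_add, Finset.range_one,
      Finset.sum_singleton, pow_zero]
    refine HasTopCoeff.sum _ fun j _ => ?_
    simpa using (hA i j).mul (HasTopCoeff.const (monoCoef D 0))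
  | succ t ih =>
    refine ⟨ih.2, fun i => ?_⟩
    simp only [iterate, monoPoly_eval, monoPoly_derivative_eval]
    refine HasTopCoeff.sub (HasTopCoeff.sum _ fun j _ => ?_) (HasTopCoeff.sum _ fun j _ => ?_)
    · have h := (hA i j).mul (((ih.2 j).pow D).const_mul (monoCoef D (t + 1)))
      rw [← sum_range_pow_succ] at h
      simpa [monoDeg] using h
    · have h := (((hA i j).pow 2).mul
        (((((ih.2 j).pow (D - 1)).const_mul (D : ℝ)).const_mul (monoCoef D (t + 1))))).mul
          (((ih.1 i).pow (monoDeg D t)).const_mul (monoCoef D t))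
      have e : 2 * 1 + (D - 1) * ∑ k ∈ Finset.range (t + 1), D ^ k +
          monoDeg D t * ∑ k ∈ Finset.range t, D ^ k = ∑ k ∈ Finset.range (t + 1 + 1), D ^ k := by
        have h1 : monoDeg D t * ∑ k ∈ Finset.range t, D ^ k =
            D * ∑ k ∈ Finset.range t, D ^ k := by
          rcases t with _ | t <;> simp [monoDeg]
        obtain ⟨d, rfl⟩ : ∃ d, D = d + 1 := ⟨D - 1, by omega⟩
        rw [h1, sum_range_pow_succ _ (t + 1), Nat.add_sub_cancel]
        have := sum_range_pow_succ (d + 1) t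
        linarith
      rw [e] at h
      exact h

lemma hasAllMoments_iterate {Ω : Type*} [MeasurableSpace Ω] {P : Measure Ω} [IsFiniteMeasure P]
    {N : ℕ} {A : Ω → Matrix (Fin N) (Fin N) ℝ} (hA : ∀ i j, HasAllMoments P fun ω => A ω i j)
    (f : ℕ → Polynomial ℝ) {x0 : Ω → Fin N → ℝ} (hx : ∀ i, HasAllMoments P fun ω => x0 ω i)
    (t : ℕ) (i : Fin N) : HasAllMoments P fun ω => iterate (A ω) f (x0 ω) t i := by
  suffices h : ∀ t, (∀ i, HasAllMoments P fun ω => iterate (A ω) f (x0 ω) t i) ∧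
      ∀ i, HasAllMoments P fun ω => iterate (A ω) f (x0 ω) (t + 1) i from (h t).1 i
  intro t
  induction t with
  | zero =>
    exact ⟨fun i => hx i, fun i => HasAllMoments.sum _ fun j _ =>
      (hA i j).mul ((hx j).polynomial_eval (f 0))⟩
  | succ t ih =>
    refine ⟨ih.2, fun i => ?_⟩
    simp only [iterate]
    exact (HasAllMoments.sum _ fun j _ => (hA i j).mul ((ih.2 j).polynomial_eval _)).sub
      (HasAllMoments.sum _ fun j _ => (((hA i j).pow 2).mul ((ih.2 j).polynomial_eval _)).mul
        ((ih.1 i).polynomial_eval _))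

/-- The lower bound for homogeneous polynomials of a Gaussian vector, for functions of the random
matrix: the deterministic symmetric matrix `U` plays the role of the direction. -/
lemma factorial_mul_sq_le_integral_sq_gaussianLaw {N : ℕ} {U : Matrix (Fin N) (Fin N) ℝ}
    (hsymm : U.IsSymm) (hdiag : ∀ x, U x x = 0) {x y : Fin N} (hxy : U x y ≠ 0) {R : ℝ}
    (hR : ∑ x, ∑ y, U x y ^ 2 ≤ R) {F : Matrix (Fin N) (Fin N) ℝ → ℝ} {M : ℕ}
    (hF : ∀ G : Matrix (Fin N) (Fin N) ℝ, HasTopCoeff (fun ξ => F (ξ • U + G)) M (F U))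
    (hint : HasAllMoments (gaussianLaw N) fun g => F (symMatrix N g)) :
    F U ^ 2 * M ! * (1 / (N * R)) ^ M ≤ ∫ g, F (symMatrix N g) ^ 2 ∂(gaussianLaw N) := by
  set u : {p : Fin N × Fin N // p.1 < p.2} → ℝ := fun e => U e.1.1 e.1.2 with hu
  have hsym : symMatrix N u = U := by
    ext a b
    simp only [symMatrix, Matrix.of_apply, hu]
    rcases lt_trichotomy a b with h | rfl | h
    · simp [h]
    · simp [hdiag]
    · simp [h, h.not_gt, hsymm.apply]
  have hlin : ∀ (ξ : ℝ) (g : {p : Fin N × Fin N // p.1 < p.2} → ℝ),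
      symMatrix N (fun k => ξ * u k + g k) = ξ • U + symMatrix N g := by
    intro ξ g
    rw [← hsym]
    ext a b
    simp only [symMatrix, Matrix.of_apply, Matrix.add_apply, Matrix.smul_apply, smul_eq_mul]
    split_ifs <;> simp
  have hne : x ≠ y := by rintro rfl; exact hxy (hdiag x)
  have hpos : 0 < ∑ k, u k ^ 2 := by
    obtain ⟨e, he⟩ := exists_symMatrix_apply_eq hne
    have h := he u
    rw [hsym] at h
    exact Finset.sum_pos' (fun k _ => sq_nonneg _)
      ⟨e, Finset.mem_univ _, by rw [← h]; positivity⟩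
  have hle : ∑ k, u k ^ 2 ≤ R := by
    refine le_trans ?_ hR
    rw [← Fintype.sum_prod_type' (f := fun a b => U a b ^ 2)]
    rw [← Finset.sum_subtype (Finset.univ.filter fun p : Fin N × Fin N => p.1 < p.2)
      (fun p => by simp) (fun p => U p.1 p.2 ^ 2)]
    exact Finset.sum_le_sum_of_subset_of_nonneg (Finset.subset_univ _) fun _ _ _ => sq_nonneg _
  have h := factorial_mul_sq_le_integral_sq_pi_gaussianReal (1 / (N : ℝ≥0)) u hpos hle
    (F := fun g => F (symMatrix N g)) (M := M) (a := F U) (fun g => by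
      simp_rw [hlin]; exact hF _) (hint.pow 2).integrable
  have e : (((1 / (N : ℝ≥0) : ℝ≥0) : ℝ) / R) = 1 / (N * R) := by
    push_cast; rw [div_div]
  rw [e] at h
  exact h

/-! ### Iterates on a signed broom -/

/-- The signed adjacency matrix of a broom: the path `0, 1, …, 2t-1` together with leaves
`2t, …, N-1` attached to the end `2t-1` of the path. Every edge has the sign `(-1)^p`, where `p` is
its endpoint closer to `0`, so that the rows of the inner vertices of the path sum to zero. -/
def broom (N t : ℕ) : Matrix (Fin N) (Fin N) ℝ := Matrix.of fun p q =>
  if q.val ≠ 0 ∧ p.val = min (q.val - 1) (2 * t - 1) then (-1) ^ p.val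
  else if p.val ≠ 0 ∧ q.val = min (p.val - 1) (2 * t - 1) then (-1) ^ q.val else 0

lemma broom_isSymm (N t : ℕ) : (broom N t).IsSymm := by
  ext p q
  simp only [Matrix.transpose_apply, broom, Matrix.of_apply]
  by_cases h1 : p.val ≠ 0 ∧ q.val = min (p.val - 1) (2 * t - 1)
  · rw [if_pos h1, if_neg (by omega), if_pos h1]
  · rw [if_neg h1]
    by_cases h2 : q.val ≠ 0 ∧ p.val = min (q.val - 1) (2 * t - 1)
    · rw [if_pos h2, if_pos h2]
    · rw [if_neg h2, if_neg h2, if_neg h1]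

lemma broom_diag (N t : ℕ) (p : Fin N) : broom N t p p = 0 := by
  simp only [broom, Matrix.of_apply]
  rw [if_neg (by omega), if_neg (by omega)]

lemma broom_path {N t p : ℕ} (hp : p + 1 < N) (h : p ≤ 2 * t - 1) :
    broom N t ⟨p, by omega⟩ ⟨p + 1, hp⟩ = (-1) ^ p := by
  simp only [broom, Matrix.of_apply]
  rw [if_pos (by omega)]

lemma broom_leaf {N t : ℕ} (ht : 1 ≤ t) (hN : 2 * t - 1 < N) {q : Fin N} (hq : 2 * t ≤ q.val) :
    broom N t ⟨2 * t - 1, hN⟩ q = -1 := by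
  simp only [broom, Matrix.of_apply]
  rw [if_pos (by omega), Odd.neg_one_pow ⟨t - 1, by omega⟩]

lemma broom_eq_zero {N t p : ℕ} (hp : p < N) (h1 : 1 ≤ p) (h2 : p + 2 ≤ 2 * t) {q : Fin N}
    (hq : q.val ≠ p - 1) (hq' : q.val ≠ p + 1) : broom N t ⟨p, hp⟩ q = 0 := by
  simp only [broom, Matrix.of_apply]
  rw [if_neg (by omega), if_neg (by omega)]

/-- A sum over the neighbours of an inner vertex of the path. -/
lemma sum_broom_neighbours {N t p : ℕ} (h1 : 1 ≤ p) (h2 : p + 2 ≤ 2 * t) (hN : 2 * t ≤ N)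
    {F : Fin N → ℝ} (hF : ∀ q, broom N t ⟨p, by omega⟩ q = 0 → F q = 0) :
    ∑ q, F q = F ⟨p - 1, by omega⟩ + F ⟨p + 1, by omega⟩ := by
  refine Fintype.sum_eq_add _ _ (by simp [Fin.ext_iff]) fun q hq => hF q ?_
  exact broom_eq_zero _ h1 h2 (fun h => hq.1 (Fin.ext h)) (fun h => hq.2 (Fin.ext h))

lemma card_filter_val_ge (N a : ℕ) :
    (Finset.univ.filter fun q : Fin N => a ≤ q.val).card = N - a := by
  have h := Fin.card_filter_val_lt (n := N) (m := a)
  have h2 := Finset.card_filter_add_card_filter_not (s := (Finset.univ : Finset (Fin N)))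
    (fun q : Fin N => q.val < a)
  simp only [not_lt, Finset.card_univ, Fintype.card_fin] at h2
  omega

lemma sum_broom_end {N t : ℕ} (ht : 1 ≤ t) (hN : 2 * t ≤ N) :
    ∑ q, broom N t ⟨2 * t - 1, by omega⟩ q = 1 - ((N - 2 * t : ℕ) : ℝ) := by
  have e : ∀ q : Fin N, broom N t ⟨2 * t - 1, by omega⟩ q =
      (if q = ⟨2 * t - 2, by omega⟩ then 1 else 0) - if 2 * t ≤ q.val then 1 else 0 := by
    intro q
    by_cases hq : 2 * t ≤ q.val
    · rw [broom_leaf ht _ hq, if_neg (by rw [Fin.ext_iff]; simp; omega), if_pos hq]; simp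
    · rw [if_neg hq, sub_zero, broom, Matrix.of_apply, if_neg (by simp; omega)]
      by_cases hq' : q.val = 2 * t - 2
      · rw [if_pos (by simp; omega), if_pos (Fin.ext hq'), hq', Even.neg_one_pow ⟨t - 1, by omega⟩]
      · rw [if_neg (by simp; omega), if_neg (fun h => hq' (by rw [h]))]
  simp_rw [e]
  rw [Finset.sum_sub_distrib, Finset.sum_ite_eq' , if_pos (Finset.mem_univ _), Finset.sum_boole,
    card_filter_val_ge]

lemma sum_sq_broom_le (N t : ℕ) : ∑ p, ∑ q, broom N t p q ^ 2 ≤ 2 * N := by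
  set a : Fin N → Fin N → ℝ := fun p q =>
    if q.val ≠ 0 ∧ p.val = min (q.val - 1) (2 * t - 1) then 1 else 0 with ha
  have hle : ∀ p q, broom N t p q ^ 2 ≤ a p q + a q p := by
    intro p q
    simp only [broom, Matrix.of_apply, ha]
    have h1 : ∀ n : ℕ, ((-1 : ℝ) ^ n) ^ 2 = 1 := fun n => by
      rw [← pow_mul, mul_comm, pow_mul]; simp
    split_ifs <;> simp [h1]
  have hcol : ∀ q, ∑ p, a p q ≤ 1 := by
    intro q
    simp only [ha]
    rw [Finset.sum_boole]
    have : (Finset.univ.filter fun p : Fin N =>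
        q.val ≠ 0 ∧ p.val = min (q.val - 1) (2 * t - 1)).card ≤ 1 := by
      rw [Finset.card_le_one]
      intro x hx y hy
      simp only [Finset.mem_filter, Finset.mem_univ, true_and] at hx hy
      exact Fin.ext (hx.2.trans hy.2.symm)
    exact_mod_cast this
  calc ∑ p, ∑ q, broom N t p q ^ 2 ≤ ∑ p, ∑ q, (a p q + a q p) :=
        Finset.sum_le_sum fun p _ => Finset.sum_le_sum fun q _ => hle p q
    _ = ∑ q, ∑ p, a p q + ∑ q, ∑ p, a p q := by
        simp_rw [Finset.sum_add_distrib]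
        rw [Finset.sum_comm]
    _ ≤ ∑ _q : Fin N, 1 + ∑ _q : Fin N, 1 := by gcongr <;> exact hcol _
    _ = 2 * N := by simp; ring

section

variable {N D t : ℕ}

/-- The iterates vanish on the part of the path which information from the ends has not reached:
there all rows sum to zero. -/
lemma iterate_broom_eq_zero (hD : 2 ≤ D) (hN : 2 * t ≤ N) {s q : ℕ} (hs : 1 ≤ s) (hsq : s ≤ q)
    (hq : q + s < 2 * t) :
    iterate (broom N t) (monoPoly D) (fun _ => 1) s ⟨q, by omega⟩ = 0 := by
  induction s generalizing q with
  | zero => omega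
  | succ s ih =>
    obtain ⟨r, rfl⟩ : ∃ r, q = r + 1 := ⟨q - 1, by omega⟩
    rcases s with _ | s
    · simp only [iterate, monoPoly_eval, one_pow, mul_one]
      rw [← Finset.sum_mul, sum_broom_neighbours (p := r + 1) (by omega) (by omega) hN
        (fun q h => h), broom_path (by omega) (by omega), ← (broom_isSymm N t).apply]
      simp only [Nat.add_sub_cancel]
      rw [broom_path (by omega) (by omega), pow_succ]
      ring
    · simp only [iterate, monoPoly_eval, monoPoly_derivative_eval]
      rw [sum_broom_neighbours (p := r + 1) (by omega) (by omega) hN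
        (fun q h => by simp [h]),
        sum_broom_neighbours (p := r + 1) (by omega) (by omega) hN
        (fun q h => by simp [h])]
      rw [ih (by omega) (by omega) (by omega), ih (by omega) (by omega) (by omega)]
      simp [monoDeg, show D ≠ 0 by omega, show D - 1 ≠ 0 by omega]

lemma iterate_one_broom_end (ht : 1 ≤ t) (hN : 2 * t ≤ N) :
    iterate (broom N t) (monoPoly D) (fun _ => 1) 1 ⟨2 * t - 1, by omega⟩ =
      -((N : ℝ) - 2 * t - 1) := by
  simp only [iterate, monoPoly_eval, one_pow, mul_one]
  rw [← Finset.sum_mul, sum_broom_end ht hN, Nat.cast_sub hN]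
  simp [monoCoef]

/-- The signal sent by the leaves travels along the path. The Onsager term vanishes at its front,
except in the first step, where it has the same sign as the leading term. -/
lemma le_abs_iterate_broom (hD : 2 ≤ D) (ht : 2 ≤ t) (hN : 2 * t + 1 ≤ N) {r : ℕ} (hr : r < t) :
    monoCoef D 1 ^ (∑ k ∈ Finset.range r, D ^ k) * ((N : ℝ) - 2 * t - 1) ^ D ^ r ≤
      |iterate (broom N t) (monoPoly D) (fun _ => 1) (r + 1) ⟨2 * t - 1 - r, by omega⟩| := by
  have hn : (0 : ℝ) ≤ (N : ℝ) - 2 * t - 1 := by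
    have : ((2 * t + 1 : ℕ) : ℝ) ≤ N := by exact_mod_cast hN
    push_cast at this; linarith
  have hc := monoCoef_pos D 1
  induction r with
  | zero =>
    have h := iterate_one_broom_end (D := D) (by omega : 1 ≤ t) (by omega : 2 * t ≤ N)
    simp only [Nat.sub_zero, zero_add, h, abs_neg, abs_of_nonneg hn]
    simp
  | succ r ih =>
    have ih := ih (by omega)
    obtain ⟨p, hp⟩ : ∃ p, 2 * t - 1 - r = p + 1 := ⟨2 * t - 2 - r, by omega⟩
    have hp' : 2 * t - 1 - (r + 1) = p := by omega
    simp only [hp, hp'] at ih ⊢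
    have step : monoCoef D 1 *
        |iterate (broom N t) (monoPoly D) (fun _ => 1) (r + 1) ⟨p + 1, by omega⟩| ^ D ≤
        |iterate (broom N t) (monoPoly D) (fun _ => 1) (r + 1 + 1) ⟨p, by omega⟩| := by
      have hback : iterate (broom N t) (monoPoly D) (fun _ => 1) (r + 1) ⟨p - 1, by omega⟩ = 0 :=
        iterate_broom_eq_zero hD (by omega) (by omega) (by omega) (by omega)
      have hcr : monoCoef D (r + 1) = monoCoef D 1 := by simp [monoCoef]
      conv_rhs => simp only [iterate, monoPoly_eval, monoPoly_derivative_eval]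
      rw [sum_broom_neighbours (t := t) (p := p) (by omega) (by omega) (by omega)
        (fun q h => by simp [h]),
        sum_broom_neighbours (t := t) (p := p) (by omega) (by omega) (by omega)
        (fun q h => by simp [h]), hback, broom_path (by omega) (by omega), hcr]
      have hdeg : monoDeg D (r + 1) = D := by simp [monoDeg]
      rw [hdeg, zero_pow (by omega : D ≠ 0), zero_pow (by omega : D - 1 ≠ 0)]
      rcases r with _ | r
      · -- `x^1 = -(n - 1)` at the end of the path, so that the term `-D` of the Onsager correction
        -- adds to its absolute value
        have hz : iterate (broom N t) (monoPoly D) (fun _ => 1) (0 + 1) ⟨p + 1, by omega⟩ =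
            -((N : ℝ) - 2 * t - 1) := by
          rw [← iterate_one_broom_end (D := D) (by omega : 1 ≤ t) (by omega : 2 * t ≤ N)]
          congr 2
          omega
        rw [hz]
        set z := (N : ℝ) - 2 * t - 1
        obtain ⟨d, rfl⟩ : ∃ d, D = d + 1 := ⟨D - 1, by omega⟩
        have hev : (-1 : ℝ) ^ p = 1 := Even.neg_one_pow ⟨t - 1, by omega⟩
        have h0 : iterate (broom N t) (monoPoly (d + 1)) (fun _ => 1) 0 ⟨p, by omega⟩ = 1 := rfl
        rw [h0, hev]
        have e : broom N t ⟨p, by omega⟩ ⟨p - 1, by omega⟩ *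
            (monoCoef (d + 1) 1 * 0) + 1 * (monoCoef (d + 1) 1 * (-z) ^ (d + 1)) -
            (broom N t ⟨p, by omega⟩ ⟨p - 1, by omega⟩ ^ 2 *
              (monoCoef (d + 1) 1 * (((d + 1 : ℕ) : ℝ) * 0)) *
                (monoCoef (d + 1) 0 * 1 ^ monoDeg (d + 1) 0) +
              1 ^ 2 * (monoCoef (d + 1) 1 * (((d + 1 : ℕ) : ℝ) * (-z) ^ (d + 1 - 1))) *
                (monoCoef (d + 1) 0 * 1 ^ monoDeg (d + 1) 0)) =
            monoCoef (d + 1) 1 * ((-z) ^ d * -(z + (d + 1 : ℕ))) := by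
          have : monoCoef (d + 1) 0 = 1 := by simp [monoCoef]
          rw [this, Nat.add_sub_cancel, pow_succ]
          ring
        rw [e, abs_mul, abs_mul, abs_pow, abs_neg, abs_neg, abs_of_pos hc, pow_succ,
          abs_of_nonneg hn, abs_of_nonneg (by positivity : 0 ≤ z + (d + 1 : ℕ))]
        gcongr
        simp
        positivity
      · -- the factor `f (x^(s-1))` of the Onsager term is evaluated ahead of the front
        have hprev : iterate (broom N t) (monoPoly D) (fun _ => 1) (r + 1) ⟨p, by omega⟩ = 0 :=
          iterate_broom_eq_zero hD (by omega) (by omega) (by omega) (by omega)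
        rw [hprev]
        have hdeg : monoDeg D (r + 1) = D := by simp [monoDeg]
        rw [hdeg, zero_pow (by omega : D ≠ 0)]
        simp only [mul_zero, add_zero, zero_add, sub_zero]
        rw [abs_mul, abs_mul, abs_pow, abs_neg, abs_one, one_pow, one_mul, abs_of_pos hc, abs_pow]
    refine le_trans (le_of_eq ?_) (le_trans (mul_le_mul_of_nonneg_left
      (pow_le_pow_left₀ (by positivity) ih D) hc.le) step)
    rw [sum_range_pow_succ, mul_pow, ← pow_mul, ← pow_mul, pow_add, pow_one, pow_succ,
      mul_comm D, mul_assoc]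

end

/-- The iteration commutes with relabelling the indices. -/
lemma iterate_submatrix {N : ℕ} (A : Matrix (Fin N) (Fin N) ℝ) (f : ℕ → Polynomial ℝ)
    (x0 : Fin N → ℝ) (σ : Equiv.Perm (Fin N)) (s : ℕ) (i : Fin N) :
    iterate (A.submatrix σ σ) f (x0 ∘ σ) s i = iterate A f x0 s (σ i) := by
  suffices h : ∀ s, (∀ i, iterate (A.submatrix σ σ) f (x0 ∘ σ) s i = iterate A f x0 s (σ i)) ∧
      ∀ i, iterate (A.submatrix σ σ) f (x0 ∘ σ) (s + 1) i = iterate A f x0 (s + 1) (σ i) from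
    (h s).1 i
  intro s
  induction s with
  | zero =>
    refine ⟨fun i => rfl, fun i => ?_⟩
    simp only [iterate, Matrix.submatrix_apply, Function.comp_apply]
    exact Equiv.sum_comp σ fun j => A (σ i) j * (f 0).eval (x0 j)
  | succ s ih =>
    refine ⟨ih.2, fun i => ?_⟩
    simp only [iterate, Matrix.submatrix_apply, ih.1, ih.2]
    congr 1
    · exact Equiv.sum_comp σ fun j => A (σ i) j * (f (s + 1)).eval (iterate A f x0 (s + 1) j)
    · exact Equiv.sum_comp σ fun j => A (σ i) j ^ 2 *
        (f (s + 1)).derivative.eval (iterate A f x0 (s + 1) j) *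
        (f s).eval (iterate A f x0 s (σ i))

/-- The broom relabelled so that the vertex `i` takes the middle position `t` of the path. -/
def broomAt {N t : ℕ} (ht : t < N) (i : Fin N) : Matrix (Fin N) (Fin N) ℝ :=
  (broom N t).submatrix (Equiv.swap i ⟨t, ht⟩) (Equiv.swap i ⟨t, ht⟩)

lemma sum_sq_broomAt_le {N t : ℕ} (ht : t < N) (i : Fin N) :
    ∑ x, ∑ y, broomAt ht i x y ^ 2 ≤ 2 * N := by
  refine le_trans (le_of_eq ?_) (sum_sq_broom_le N t)
  simp only [broomAt, Matrix.submatrix_apply]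
  rw [Equiv.sum_comp (Equiv.swap i ⟨t, ht⟩)
    (fun p => ∑ y, broom N t p (Equiv.swap i ⟨t, ht⟩ y) ^ 2)]
  exact Finset.sum_congr rfl fun p _ =>
    Equiv.sum_comp (Equiv.swap i ⟨t, ht⟩) fun q => broom N t p q ^ 2

/-- Lower bound for the second moment of the iterate in terms of its value at the broom. -/
lemma le_integral_iterate_sq {N D t : ℕ} (hD : 2 ≤ D) (ht : 2 ≤ t) (hN : 2 * t + 1 ≤ N)
    (i : Fin N) :
    (monoCoef D 1 ^ (∑ k ∈ Finset.range (t - 1), D ^ k) *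
        ((N : ℝ) - 2 * t - 1) ^ D ^ (t - 1)) ^ 2 * (∑ k ∈ Finset.range t, D ^ k)! *
        (1 / (N * (2 * N) : ℝ)) ^ (∑ k ∈ Finset.range t, D ^ k) ≤
      ∫ g, iterate (symMatrix N g) (monoPoly D) (fun _ => 1) t i ^ 2 ∂(gaussianLaw N) := by
  have htN : t < N := by omega
  have hval : monoCoef D 1 ^ (∑ k ∈ Finset.range (t - 1), D ^ k) *
      ((N : ℝ) - 2 * t - 1) ^ D ^ (t - 1) ≤
      |iterate (broomAt htN i) (monoPoly D) (fun _ => 1) t i| := by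
    have h := le_abs_iterate_broom hD ht hN (r := t - 1) (by omega)
    have e : iterate (broomAt htN i) (monoPoly D) (fun _ => 1) t i =
        iterate (broom N t) (monoPoly D) (fun _ => 1) t ⟨t, htN⟩ := by
      have := iterate_submatrix (broom N t) (monoPoly D) (fun _ => 1) (Equiv.swap i ⟨t, htN⟩) t i
      rw [Equiv.swap_apply_left] at this
      exact this
    rw [e]
    convert h using 4 <;> omega
  have hn : (0 : ℝ) ≤ (N : ℝ) - 2 * t - 1 := by
    have : ((2 * t + 1 : ℕ) : ℝ) ≤ N := by exact_mod_cast hN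
    push_cast at this; linarith
  have hc := monoCoef_pos D 1
  have hne : broomAt htN i (Equiv.swap i ⟨t, htN⟩ ⟨0, by omega⟩)
      (Equiv.swap i ⟨t, htN⟩ ⟨1, by omega⟩) ≠ 0 := by
    simp only [broomAt, Matrix.submatrix_apply, Equiv.swap_apply_self]
    rw [broom_path (by omega) (by omega)]
    simp
  refine le_trans ?_ (factorial_mul_sq_le_integral_sq_gaussianLaw
    (F := fun A => iterate A (monoPoly D) (fun _ => 1) t i) (U := broomAt htN i)
    ((broom_isSymm N t).submatrix _) (fun x => broom_diag N t _) hne (sum_sq_broomAt_le htN i)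
    (fun G => hasTopCoeff_iterate (by omega) _ G t i)
    (hasAllMoments_iterate hasAllMoments_symMatrix_apply _
      (fun _ => HasAllMoments.const 1) t i))
  rw [← sq_abs (iterate (broomAt htN i) _ _ _ _)]
  gcongr

/-! ### The tree contribution -/

/-- Mixed moments of centred independent Gaussian variables are nonnegative. -/
lemma integral_prod_symMatrix_nonneg {N : ℕ} {κ : Type*} [Fintype κ] (x y : κ → Fin N) :
    0 ≤ ∫ g, ∏ k, symMatrix N g (x k) (y k) ∂(gaussianLaw N) := by
  by_cases h : ∃ k, x k = y k
  · obtain ⟨k, hk⟩ := h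
    have : ∀ g, ∏ k, symMatrix N g (x k) (y k) = 0 := fun g =>
      Finset.prod_eq_zero (Finset.mem_univ k) (by rw [hk, symMatrix_diag])
    simp [this]
  · push Not at h
    choose e he using fun k => exists_symMatrix_apply_eq (h k)
    have e1 : ∀ g, ∏ k, symMatrix N g (x k) (y k) =
        ∏ ε, g ε ^ (Finset.univ.filter fun k => e k = ε).card := by
      intro g
      simp_rw [he]
      rw [← Finset.prod_fiberwise_of_maps_to' (s := Finset.univ) (t := Finset.univ) (g := e)
        (fun k _ => Finset.mem_univ _) (fun ε => g ε)]
      simp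
    simp_rw [e1]
    rw [gaussianLaw, integral_fintype_prod_eq_prod
      (f := fun ε (x : ℝ) => x ^ (Finset.univ.filter fun k => e k = ε).card)]
    exact Finset.prod_nonneg fun ε _ => integral_pow_gaussianReal_nonneg _ _

lemma integral_treeVal_nonneg {N t : ℕ} {b : ℕ → ℕ} {coef : ℕ → ℝ} (hcoef : ∀ r, 0 ≤ coef r)
    (lab : Labeling b t N) :
    0 ≤ ∫ g, treeVal coef (symMatrix N g) (fun _ => 1) lab ∂(gaussianLaw N) := by
  simp only [treeVal, Finset.prod_const_one, mul_one]
  rw [integral_const_mul]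
  refine mul_nonneg (Finset.prod_nonneg fun s _ => Finset.prod_nonneg fun _ _ => hcoef _) ?_
  have h := integral_prod_symMatrix_nonneg
    (fun k : (Σ s : Fin t, Level b (s + 1)) => lab k.1.castSucc (parent k.2))
    (fun k => lab k.1.succ k.2)
  simp_rw [Fintype.prod_sigma] at h
  exact h

lemma card_level_branching {D t m s : ℕ} (hs : s < t) :
    Fintype.card (Level (branching (monoDeg D) t m) (s + 1)) = m * D ^ s := by
  rw [Fintype.card_pi]
  simp only [Fintype.card_fin]
  rw [Fin.prod_univ_succ]
  have : ∀ r : Fin s, branching (monoDeg D) t m (r.succ : ℕ) = D := by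
    intro r
    have := r.2
    simp [branching, monoDeg, show t - (r.val + 1) ≠ 0 by omega]
  simp_rw [this]
  simp [branching]

/-- The labeling which is constant, equal to `path s`, on every depth `s < t`, and equal to `leaf`
on the leaves. -/
def pathLabeling {b : ℕ → ℕ} {t N : ℕ} (path : ℕ → Fin N) (leaf : Level b t → Fin N) :
    Labeling b t N := fun s v =>
  if h : s.val = t then leaf fun r => v ⟨r, by omega⟩ else path s

section

variable {b : ℕ → ℕ} {t N : ℕ} {path : ℕ → Fin N}

lemma pathLabeling_of_ne {leaf : Level b t → Fin N} {s : Fin (t + 1)} (hs : s.val ≠ t)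
    (v : Level b s) : pathLabeling path leaf s v = path s := by
  simp [pathLabeling, hs]

lemma pathLabeling_last (leaf : Level b t → Fin N) (v : Level b t) :
    pathLabeling path leaf (Fin.last t) v = leaf v := by
  simp [pathLabeling]

lemma pathLabeling_injective : Function.Injective (pathLabeling (b := b) (t := t) path) := by
  intro l l' h
  ext1 v
  rw [← pathLabeling_last (path := path) l v, h, pathLabeling_last]

lemma isAdmissible_pathLabeling {i : Fin N} (ht : 2 ≤ t) (h0 : path 0 = i)
    (hpath : ∀ s, s + 2 < t → path (s + 2) ≠ path s) {leaf : Level b t → Fin N}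
    (hleaf : ∀ v, leaf v ≠ path (t - 2)) : IsAdmissible i (pathLabeling path leaf) := by
  refine ⟨fun v => ?_, fun s hs v => ?_⟩
  · rw [pathLabeling_of_ne (by simp; omega)]
    simpa using h0
  · rw [pathLabeling_of_ne (s := ⟨s, by omega⟩) (by simp; omega)]
    rcases hs.lt_or_eq with h | h
    · rw [pathLabeling_of_ne (by simp; omega)]
      exact hpath s h
    · subst h
      exact fun h => hleaf v ((pathLabeling_last leaf v).symm.trans h)

end

lemma treeVal_pathLabeling {b : ℕ → ℕ} {T N : ℕ} (coef : ℕ → ℝ) (A : Matrix (Fin N) (Fin N) ℝ)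
    (path : ℕ → Fin N) (leaf : Level b (T + 1) → Fin N) :
    treeVal coef A (fun _ => 1) (pathLabeling path leaf) =
      (∏ s : Fin (T + 1), coef (s + 1) ^ Fintype.card (Level b (s + 1))) *
      ((∏ s : Fin T, A (path s) (path (s + 1)) ^ Fintype.card (Level b (s + 1))) *
        ∏ v, A (path T) (leaf v)) := by
  simp only [treeVal, Finset.prod_const_one, mul_one, Finset.prod_const, Finset.card_univ]
  congr 1
  rw [Fin.prod_univ_castSucc]
  congr 1
  · refine Finset.prod_congr rfl fun s _ => ?_
    have hs := s.2
    rw [← Finset.card_univ, ← Finset.prod_const]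
    refine Finset.prod_congr rfl fun v _ => ?_
    rw [pathLabeling_of_ne (by simp; omega), pathLabeling_of_ne (by simp; omega)]
    simp
  · refine Finset.prod_congr rfl fun v _ => ?_
    rw [pathLabeling_of_ne (by simp)]
    have := pathLabeling_last (path := path) leaf v
    congr 1

open Classical in
/-- Restricting to labelings which are constant on every level except the leaves, and whose leaves
are labelled freely in `J`, bounds the tree contribution from below. -/
lemma integral_path_le_treeContribution {N D T m : ℕ} (hT : 1 ≤ T) {i : Fin N}
    {path : ℕ → Fin N} (h0 : path 0 = i) (hpath : ∀ s, s + 2 < T + 1 → path (s + 2) ≠ path s)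
    {J : Finset (Fin N)} (hJ : path (T - 1) ∉ J) :
    monoCoef D 1 ^ (m * ∑ s ∈ Finset.range T, D ^ s) *
      ∫ g, (∏ s : Fin T, symMatrix N g (path s) (path (s + 1)) ^ (m * D ^ s.val)) *
        (∑ j ∈ J, symMatrix N g (path T) j) ^ (m * D ^ T) ∂(gaussianLaw N) ≤
      treeContribution (gaussianLaw N) (symMatrix N) (monoCoef D) (monoDeg D) (fun _ _ => 1)
        (T + 1) m i := by
  set b := branching (monoDeg D) (T + 1) m with hb
  set L : Finset (Level b (T + 1) → Fin N) := Fintype.piFinset fun _ => J with hL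
  have hcard : ∀ s : Fin (T + 1), Fintype.card (Level b (s + 1)) = m * D ^ s.val := fun s =>
    card_level_branching s.2
  have hcoef : ∏ s : Fin (T + 1), monoCoef D (T + 1 - (s + 1)) ^ Fintype.card (Level b (s + 1)) =
      monoCoef D 1 ^ (m * ∑ s ∈ Finset.range T, D ^ s) := by
    simp_rw [hcard]
    rw [Fin.prod_univ_castSucc]
    have hlast : monoCoef D (T + 1 - ((Fin.last T).val + 1)) = 1 := by simp [monoCoef]
    have hc : ∀ s : Fin T, monoCoef D (T + 1 - (s.castSucc.val + 1)) = monoCoef D 1 := by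
      intro s
      have := s.2
      simp [monoCoef, show T - s.val ≠ 0 by omega]
    rw [hlast, one_pow, mul_one]
    simp_rw [hc]
    rw [Finset.prod_pow_eq_pow_sum, Finset.mul_sum, Finset.sum_range]
    rfl
  have hmom : ∀ leaf : Level b (T + 1) → Fin N, HasAllMoments (gaussianLaw N) fun g =>
      treeVal (fun r => monoCoef D (T + 1 - r)) (symMatrix N g) (fun _ => 1)
        (pathLabeling path leaf) := by
    intro leaf
    simp_rw [treeVal_pathLabeling]
    exact (HasAllMoments.const _).mul ((HasAllMoments.prod _ fun s _ =>
      (hasAllMoments_symMatrix_apply _ _).pow _).mul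
        (HasAllMoments.prod _ fun v _ => hasAllMoments_symMatrix_apply _ _))
  calc _ = ∫ g, ∑ leaf ∈ L, treeVal (fun r => monoCoef D (T + 1 - r)) (symMatrix N g)
        (fun _ => 1) (pathLabeling path leaf) ∂(gaussianLaw N) := by
        rw [← integral_const_mul]
        congr 1
        ext g
        simp_rw [treeVal_pathLabeling, hcoef]
        rw [← Finset.mul_sum, ← Finset.mul_sum, hL,
          ← Finset.prod_univ_sum (fun _ => J) (fun _ j => symMatrix N g (path T) j),
          Finset.prod_const, Finset.card_univ, card_level_branching (Nat.lt_succ_self T)]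
        congr 2
        exact Finset.prod_congr rfl fun s _ => congrArg (fun n => _ ^ n) (hcard s.castSucc).symm
    _ = ∑ leaf ∈ L, ∫ g, treeVal (fun r => monoCoef D (T + 1 - r)) (symMatrix N g)
        (fun _ => 1) (pathLabeling path leaf) ∂(gaussianLaw N) :=
        integral_finsetSum _ fun leaf _ => (hmom leaf).integrable
    _ = ∑ lab ∈ L.image (pathLabeling path), ∫ g, treeVal (fun r => monoCoef D (T + 1 - r))
        (symMatrix N g) (fun _ => 1) lab ∂(gaussianLaw N) := by
        rw [Finset.sum_image fun _ _ _ _ h => pathLabeling_injective h]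
    _ ≤ _ := by
        refine Finset.sum_le_sum_of_subset_of_nonneg (fun lab hlab => ?_) fun lab _ _ =>
          integral_treeVal_nonneg (fun r => (monoCoef_pos D _).le) lab
        obtain ⟨leaf, hleaf, rfl⟩ := Finset.mem_image.1 hlab
        refine Finset.mem_filter.2 ⟨Finset.mem_univ _,
          isAdmissible_pathLabeling (by omega) h0 hpath fun v h => hJ ?_⟩
        have := Fintype.mem_piFinset.1 hleaf v
        rw [h] at this
        exact this

/-- Lower bound for the tree contribution, obtained from the path and the leaves of the broom. -/
lemma le_treeContribution {N D t k : ℕ} (ht : 2 ≤ t) (hN : 2 * t + 1 ≤ N) (i : Fin N) :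
    (monoCoef D 1 ^ (k * ∑ s ∈ Finset.range (t - 1), D ^ s) *
        ((N : ℝ) - 2 * t) ^ (k * D ^ (t - 1))) ^ 2 * (k * ∑ s ∈ Finset.range t, D ^ s)! *
        (1 / (N * (2 * N) : ℝ)) ^ (k * ∑ s ∈ Finset.range t, D ^ s) ≤
      treeContribution (gaussianLaw N) (symMatrix N) (monoCoef D) (monoDeg D) (fun _ _ => 1)
        t (2 * k) i := by
  obtain ⟨T, rfl⟩ : ∃ T, t = T + 1 := ⟨t - 1, by omega⟩
  rw [Nat.add_sub_cancel]
  have htN : T + 1 < N := by omega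
  set σ : Equiv.Perm (Fin N) := Equiv.swap i ⟨T + 1, htN⟩ with hσ
  have hσσ : ∀ x, σ (σ x) = x := fun x => Equiv.swap_apply_self _ _ _
  -- only the values of the path at `s ≤ T` matter
  set path : ℕ → Fin N := fun s =>
    if h : T + 1 + s < N then σ ⟨T + 1 + s, h⟩ else i with hpath
  have hp : ∀ s (hs : s ≤ T), path s = σ ⟨T + 1 + s, by omega⟩ := fun s hs => by
    simp only [hpath]; rw [dif_pos]
  set J : Finset (Fin N) := Finset.univ.filter fun j => 2 * (T + 1) ≤ (σ j).val with hJ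
  set F : Matrix (Fin N) (Fin N) ℝ → ℝ := fun A =>
    (∏ s : Fin T, A (path s) (path (s + 1)) ^ (k * D ^ s.val)) *
      (∑ j ∈ J, A (path T) j) ^ (k * D ^ T) with hF
  set U := broomAt htN i with hU
  have hUσ : ∀ x y, U (σ x) y = broom N (T + 1) x (σ y) := fun x y => by
    simp only [hU, broomAt, Matrix.submatrix_apply, ← hσ, hσσ]
  have hS : ∑ j ∈ J, U (path T) j = -((N : ℝ) - 2 * ((T + 1 : ℕ) : ℝ)) := by
    have : ∀ j ∈ J, U (path T) j = -1 := by
      intro j hj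
      rw [hp T le_rfl, hUσ]
      have h := broom_leaf (t := T + 1) (by omega) (by omega) (Finset.mem_filter.1 hj).2
      convert h using 3
      omega
    rw [Finset.sum_congr rfl this, Finset.sum_const]
    have hc : J.card = N - 2 * (T + 1) := by
      rw [← card_filter_val_ge N (2 * (T + 1))]
      exact Finset.card_equiv σ fun j => by simp [hJ]
    rw [hc, nsmul_eq_mul, Nat.cast_sub (by omega)]
    push_cast; ring
  have hFU : F U ^ 2 = (((N : ℝ) - 2 * ((T + 1 : ℕ) : ℝ)) ^ (k * D ^ T)) ^ 2 := by
    have hprod : (∏ s : Fin T, U (path s) (path (s + 1)) ^ (k * D ^ s.val)) ^ 2 = 1 := by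
      rw [← Finset.prod_pow]
      refine Finset.prod_eq_one fun s _ => ?_
      have hs := s.2
      rw [hp s (by omega), hp (s + 1) (by omega), hUσ, hσσ]
      have h := broom_path (N := N) (t := T + 1) (p := T + 1 + s) (by omega) (by omega)
      have h' : broom N (T + 1) ⟨T + 1 + s, by omega⟩ ⟨T + 1 + (s + 1), by omega⟩ =
        (-1) ^ (T + 1 + s.val) := h
      rw [h', ← pow_mul, ← pow_mul]
      exact Even.neg_one_pow ((even_two.mul_left _).mul_left _)
    simp only [hF]
    rw [mul_pow, hprod, one_mul, hS, ← pow_mul, ← pow_mul]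
    exact Even.neg_pow (even_two.mul_left _) _
  have hdeg : ∑ s : Fin T, k * D ^ s.val * 1 + k * D ^ T * 1 =
      k * ∑ s ∈ Finset.range (T + 1), D ^ s := by
    rw [Finset.sum_range_succ, mul_add, Finset.mul_sum, Finset.sum_range]
    simp
  have hA : ∀ (G : Matrix (Fin N) (Fin N) ℝ) x y,
      HasTopCoeff (fun ξ => (ξ • U + G) x y) 1 (U x y) := fun G x y => by
    simpa using HasTopCoeff.linear (U x y) (G x y)
  have hne : U (σ ⟨0, by omega⟩) (σ ⟨1, by omega⟩) ≠ 0 := by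
    rw [hUσ, hσσ, broom_path (by omega) (by omega)]
    simp
  have h1 := factorial_mul_sq_le_integral_sq_gaussianLaw (U := U) (F := F)
    (M := k * ∑ s ∈ Finset.range (T + 1), D ^ s)
    ((broom_isSymm N (T + 1)).submatrix _) (fun x => broom_diag N (T + 1) _) hne
    (sum_sq_broomAt_le htN i)
    (fun G => by
      rw [← hdeg]
      exact (HasTopCoeff.prod _ fun s _ => (hA G _ _).pow _).mul
        ((HasTopCoeff.sum _ fun j _ => hA G _ _).pow _))
    ((HasAllMoments.prod _ fun s _ => (hasAllMoments_symMatrix_apply _ _).pow _).mul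
        ((HasAllMoments.sum _ fun v _ => hasAllMoments_symMatrix_apply _ _).pow _))
  have h2 := integral_path_le_treeContribution (D := D) (m := 2 * k) (by omega : 1 ≤ T)
    (path := path) (i := i) (J := J) (by rw [hp 0 (by omega)]; exact Equiv.swap_apply_right _ _)
    (fun s hs => by
      rw [hp (s + 2) (by omega), hp s (by omega)]
      simp [Fin.ext_iff])
    (by
      rw [hp (T - 1) (by omega)]
      simp only [hJ, Finset.mem_filter, Finset.mem_univ, true_and, hσσ]
      omega)
  refine le_trans ?_ h2
  have h3 : ∀ g, (∏ s : Fin T, symMatrix N g (path s) (path (s + 1)) ^ (2 * k * D ^ s.val)) *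
        (∑ j ∈ J, symMatrix N g (path T) j) ^ (2 * k * D ^ T) = F (symMatrix N g) ^ 2 := by
    intro g
    simp only [hF]
    rw [mul_pow, ← Finset.prod_pow, ← pow_mul]
    congr 1
    · exact Finset.prod_congr rfl fun s _ => by rw [← pow_mul]; congr 1; ring
    · congr 1; ring
  simp_rw [h3]
  rw [mul_pow, ← hFU, ← pow_mul, mul_assoc, mul_assoc]
  have hc := monoCoef_pos D 1
  refine le_trans (le_of_eq ?_) (mul_le_mul_of_nonneg_left h1 (by positivity))
  rw [show k * (∑ s ∈ Finset.range T, D ^ s) * 2 = 2 * k * ∑ s ∈ Finset.range T, D ^ s by ring]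
  ring

/-! ### Size of the lower bounds -/

lemma doubleFactorial_two_mul_sub_one_le_pow (D : ℕ) : (2 * D - 1)‼ ≤ D ^ D := by
  induction D with
  | zero => simp
  | succ D ih =>
    rcases Nat.eq_zero_or_pos D with rfl | hD
    · simp
    · have h1 : (2 * (D + 1) - 1)‼ = (2 * D + 1) * (2 * D - 1)‼ := by
        rw [show 2 * (D + 1) - 1 = (2 * D - 1) + 2 by omega, Nat.doubleFactorial_add_two]
        congr 1; omega
      have h2 : 2 * D ^ D ≤ (D + 1) ^ D := by
        have h3 : ∀ n, (n + D) * D ^ n ≤ D * (D + 1) ^ n := by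
          intro n
          induction n with
          | zero => simp
          | succ n ihn =>
            calc (n + 1 + D) * D ^ (n + 1) ≤ (n + D) * D ^ n * (D + 1) := by
                  rw [pow_succ]; nlinarith [Nat.zero_le (n * D ^ n)]
              _ ≤ D * (D + 1) ^ n * (D + 1) := Nat.mul_le_mul_right _ ihn
              _ = D * (D + 1) ^ (n + 1) := by ring
        have h4 := h3 D
        exact Nat.le_of_mul_le_mul_left (by linarith) hD
      calc (2 * (D + 1) - 1)‼ = (2 * D + 1) * (2 * D - 1)‼ := h1
        _ ≤ (2 * D + 1) * D ^ D := Nat.mul_le_mul_left _ ih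
        _ ≤ (D + 1) * (2 * D ^ D) := by nlinarith [Nat.zero_le (D ^ D)]
        _ ≤ (D + 1) * (D + 1) ^ D := Nat.mul_le_mul_left _ h2
        _ = (D + 1) ^ (D + 1) := by ring

lemma neg_mul_log_le_two_mul_log_monoCoef (D : ℕ) :
    -(D * Real.log D) ≤ 2 * Real.log (monoCoef D 1) := by
  have h0 := doubleFactorial_pos_real (2 * D - 1)
  have h : Real.log ((2 * D - 1)‼ : ℝ) ≤ D * Real.log D := by
    rw [← Real.log_pow]
    exact Real.log_le_log h0 (by exact_mod_cast doubleFactorial_two_mul_sub_one_le_pow D)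
  have e : 2 * Real.log (monoCoef D 1) = -Real.log ((2 * D - 1)‼ : ℝ) := by
    rw [monoCoef, if_neg one_ne_zero, one_div, Real.log_inv, Real.log_sqrt h0.le]
    ring
  linarith

lemma mul_log_sub_le_log_factorial (n : ℕ) : n * Real.log n - n ≤ Real.log (n ! : ℝ) := by
  rcases Nat.eq_zero_or_pos n with rfl | hn
  · simp
  · have h := Real.pow_div_factorial_le_exp (n : ℝ) (Nat.cast_nonneg n) n
    have hf : (0 : ℝ) < n ! := by exact_mod_cast Nat.factorial_pos n
    have hn' : (0 : ℝ) < n := by exact_mod_cast hn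
    have h2 := Real.log_le_log (by positivity) h
    rw [Real.log_exp, Real.log_div (by positivity) hf.ne', Real.log_pow] at h2
    linarith

/-- Both moment lower bounds have this form, with `n` close to the number of leaves of the broom.
Per unit of `k`, and up to lower-order terms, the logarithm of the factorial is at least
`E (t-1) log D` with `E = D^(t-1)`; the coefficients cost `E log D`, and the inner edges of the
tree, which are fewer than the leaves by a factor of about `D`, cost `O(E log N / D)`. The first
term dominates as soon as `t` is a large multiple of `log N / (D log D)`. -/
lemma exp_le_moment_lower_bound {N D t k : ℕ} {n : ℝ} (hk : 1 ≤ k) (ht : 3 ≤ t) (hN : 3 ≤ N)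
    (hD : 24 ≤ Real.log D) (hn : (N : ℝ) / 2 ≤ n)
    (hC : 48 * (Real.log N / (D * Real.log D)) ≤ t) :
    Real.exp (1 / 24 * (2 * k : ℕ) * (D : ℝ) ^ (t - 1) * t * Real.log D) ≤
      (monoCoef D 1 ^ (k * ∑ s ∈ Finset.range (t - 1), D ^ s) * n ^ (k * D ^ (t - 1))) ^ 2 *
        (k * ∑ s ∈ Finset.range t, D ^ s)! *
        (1 / (N * (2 * N) : ℝ)) ^ (k * ∑ s ∈ Finset.range t, D ^ s) := by
  set S : ℕ := ∑ s ∈ Finset.range (t - 1), D ^ s with hS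
  set E : ℕ := D ^ (t - 1) with hE
  set l : ℝ := Real.log D with hl
  set L : ℝ := Real.log N with hL
  have hsum : ∑ s ∈ Finset.range t, D ^ s = S + E := by
    obtain ⟨T, rfl⟩ : ∃ T, t = T + 1 := ⟨t - 1, by omega⟩
    rw [Finset.sum_range_succ]; rfl
  have hgeom : S + E = 1 + D * S := by
    rw [← hsum, hS, ← sum_range_pow_succ]
    congr 2; omega
  rw [hsum]
  have hN' : (3 : ℝ) ≤ N := by exact_mod_cast hN
  have hn0 : 0 < n := by linarith
  have hc := monoCoef_pos D 1
  have hDl : l ≤ D := (Real.log_le_sub_one_of_pos (by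
    by_contra h
    have : (D : ℝ) = 0 := le_antisymm (not_lt.1 h) (Nat.cast_nonneg D)
    rw [hl, this] at hD; simp at hD; linarith)).trans (by linarith)
  have hD0 : (24 : ℝ) ≤ D := hD.trans hDl
  have hL1 : 1 ≤ L := by
    rw [hL, Real.le_log_iff_exp_le (by linarith)]
    linarith [Real.exp_one_lt_d9]
  have hlog2 : Real.log 2 ≤ 0.7 := by linarith [Real.log_two_lt_d9]
  have hlog2' : 0 ≤ Real.log 2 := Real.log_nonneg (by norm_num)
  have hE1 : (1 : ℝ) ≤ E := by
    rw [hE]; push_cast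
    exact one_le_pow₀ (by linarith)
  have hgeom' : (S : ℝ) + E = 1 + D * S := by exact_mod_cast hgeom
  have hS0 : (0 : ℝ) ≤ S := Nat.cast_nonneg S
  have hk' : (1 : ℝ) ≤ k := by exact_mod_cast hk
  have ht' : (3 : ℝ) ≤ t := by exact_mod_cast ht
  -- `D S = E + S - 1` and `S ≤ 2 E / D`
  have hDS : D * S ≤ 2 * (E : ℝ) := by nlinarith
  have hlogn : L - Real.log 2 ≤ Real.log n := by
    rw [hL, ← Real.log_div (by linarith) (by norm_num)]
    exact Real.log_le_log (by linarith) hn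
  have hfac : (k * (S + E : ℝ)) * ((t - 1) * l) - k * (S + E) ≤
      Real.log ((k * (S + E))! : ℝ) := by
    refine le_trans ?_ (mul_log_sub_le_log_factorial _)
    have h1 : (t - 1) * l ≤ Real.log ((k * (S + E) : ℕ) : ℝ) := by
      have : (t - 1) * l = Real.log (E : ℝ) := by
        rw [hE, Nat.cast_pow, Real.log_pow, Nat.cast_sub (by omega)]; simp [hl]
      rw [this]
      refine Real.log_le_log (by linarith) ?_
      push_cast
      nlinarith
    push_cast at h1 ⊢
    have : 0 ≤ (k * (S + E : ℝ)) := by positivity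
    nlinarith [mul_le_mul_of_nonneg_left h1 this]
  have hcoef := mul_le_mul_of_nonneg_left (neg_mul_log_le_two_mul_log_monoCoef D) hS0
  have hDL : 48 * L ≤ t * (D * l) := by
    have : 0 < D * l := by positivity
    rwa [← mul_div_assoc, div_le_iff₀ this] at hC
  -- the cost of the inner edges
  have hinner : S * (1 + Real.log 2 + 2 * L) ≤ E * (t * l / 6) := by
    have h1 : S * (1 + Real.log 2 + 2 * L) ≤ S * (4 * L) := by
      gcongr; linarith
    have h2 : S * (48 * L) ≤ S * (t * (D * l)) := by gcongr
    have h3 : D * S * (t * l) ≤ 2 * E * (t * l) := by gcongr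
    nlinarith
  have hSl : S * l ≤ 2 * E := (mul_le_mul_of_nonneg_left hDl hS0).trans (by linarith)
  have htl : 72 ≤ t * l := by nlinarith
  -- the logarithm of the claim, divided by `k`; here `t - 2 ≥ t / 3` absorbs the losses
  have main : E * (t * l / 12) ≤
      S * (2 * Real.log (monoCoef D 1)) + 2 * (E * Real.log n) +
        ((S + E) * ((t - 1) * l) - (S + E)) - (S + E) * (Real.log 2 + 2 * L) := by
    have h1 : E * (L - Real.log 2) ≤ E * Real.log n := by gcongr
    have h2 : 0 ≤ S * ((t - 1) * l) := by
      have : 0 ≤ (t - 1 : ℝ) := by linarith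
      positivity
    have h3 : S * (D * l) = E * l + S * l - l := by
      linear_combination (-l) * hgeom'
    have h4 : (E : ℝ) * 72 ≤ E * (t * l) := by gcongr
    have h5 : E * (3 * l) ≤ E * (t * l) := by gcongr
    have h6 : E * Real.log 2 ≤ E * 0.7 := by gcongr
    linarith
  have hNN : Real.log (1 / (N * (2 * N) : ℝ)) = -(Real.log 2 + 2 * L) := by
    rw [one_div, Real.log_inv, Real.log_mul (by positivity) (by positivity),
      Real.log_mul (by positivity) (by positivity)]
    ring
  rw [← Real.le_log_iff_exp_le (by positivity), Real.log_mul (by positivity) (by positivity),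
    Real.log_mul (by positivity) (by positivity), Real.log_pow, Real.log_mul (by positivity)
    (by positivity), Real.log_pow, Real.log_pow, Real.log_pow, hNN]
  have hE' : (D : ℝ) ^ (t - 1) = E := by rw [hE]; push_cast; rfl
  rw [hE']
  push_cast
  have := mul_le_mul_of_nonneg_left main (by linarith : (0 : ℝ) ≤ k)
  linarith

/-! ### Conclusion -/

lemma seMoment_monoPoly (D t m : ℕ) :
    seMoment (monoPoly D) 1 t m = ∫ y, y ^ m ∂(gaussianReal 0 1) := by
  rw [seMoment, seVar_monoPoly, Real.toNNReal_one]

lemma sq_le_one_add_pow {m : ℕ} (hm : 2 ≤ m) (he : Even m) (x : ℝ) : x ^ 2 ≤ 1 + x ^ m := by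
  rw [← sq_abs x, ← he.pow_abs x]
  rcases le_total |x| 1 with h | h
  · have := pow_le_one₀ (n := 2) (abs_nonneg x) h
    have := pow_nonneg (abs_nonneg x) m
    linarith
  · have := pow_le_pow_right₀ h hm
    linarith

/-- The horizon is `O(log N)`, so that a broom with a path of `2 t` vertices and at least `N / 2 + 1`
leaves fits into `N` vertices. -/
lemma eventually_four_mul_add_two_le {K : ℝ} {D t : ℕ → ℕ} (hD : Tendsto D atTop atTop)
    (hK : ∀ᶠ N : ℕ in atTop, (t N : ℝ) ≤ K * (Real.log N / Real.log (D N))) :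
    ∀ᶠ N : ℕ in atTop, 4 * t N + 2 ≤ N := by
  have hlog : Tendsto (fun N => Real.log (D N)) atTop atTop :=
    Real.tendsto_log_atTop.comp (tendsto_natCast_atTop_atTop.comp hD)
  have ho := (Real.isLittleO_log_id_atTop.comp_tendsto
    (tendsto_natCast_atTop_atTop (R := ℝ))).bound
    (show (0 : ℝ) < 1 / (8 * (|K| + 1)) by positivity)
  filter_upwards [hK, hlog.eventually_ge_atTop 1, ho, eventually_ge_atTop 4] with N h1 h2 h3 h4
  simp only [Function.comp_apply, id, Real.norm_eq_abs, Nat.abs_cast] at h3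
  have hN : (4 : ℝ) ≤ N := by exact_mod_cast h4
  have hL : 0 ≤ Real.log N := Real.log_nonneg (by linarith)
  rw [abs_of_nonneg hL, div_mul_eq_mul_div, one_mul, le_div_iff₀ (by positivity)] at h3
  have h5 : K * (Real.log N / Real.log (D N)) ≤ |K| * Real.log N := by
    refine mul_le_mul (le_abs_self K) (div_le_self hL h2) ?_ (abs_nonneg K)
    exact div_nonneg hL (by linarith)
  have : (4 * t N + 2 : ℝ) ≤ N := by nlinarith
  exact_mod_cast this

end AMP

end

theorem mainTheorem6 :
    -- the Gaussian monomial instance satisfies the definition of an AMP instance and the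
    -- uniform boundedness assumption, with constants independent of `N` and `D`
    (∀ N D : ℕ, 1 ≤ D →
      AMP.IsInstance (AMP.gaussianLaw N) (AMP.symMatrix N) (AMP.monoPoly D)
          (fun _ _ => 1) D 1 1 1 ∧
        (∀ s, AMP.seVar (AMP.monoPoly D) 1 s = 1) ∧
        ∀ t, AMP.UniformlyBounded (AMP.monoPoly D) 1 t 1) ∧
    -- in the regime `log N / (D log D) ≲ t ≲ log N / log D`, the tree contribution diverges
    -- and state evolution fails
    ∃ C > (0 : ℝ), ∃ c > (0 : ℝ),
      ∀ (K : ℝ) (D t : ℕ → ℕ), Tendsto D atTop atTop →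
        (∀ᶠ N : ℕ in atTop, 3 ≤ t N) →
        (∀ᶠ N : ℕ in atTop, C * (Real.log N / (D N * Real.log (D N))) ≤ t N) →
        (∀ᶠ N : ℕ in atTop, (t N : ℝ) ≤ K * (Real.log N / Real.log (D N))) →
        ∀ m : ℕ, 2 ≤ m → Even m →
          (∀ᶠ N : ℕ in atTop, ∀ i : Fin N,
            Real.exp (c * m * (D N : ℝ) ^ (t N - 1) * t N * Real.log (D N)) ≤
              AMP.treeContribution (AMP.gaussianLaw N) (AMP.symMatrix N)
                (AMP.monoCoef (D N)) (AMP.monoDeg (D N)) (fun _ _ => 1) (t N) m i) ∧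
          (∀ R : ℝ, ∀ᶠ N : ℕ in atTop, ∀ i : Fin N,
            R ≤ AMP.treeContribution (AMP.gaussianLaw N) (AMP.symMatrix N)
                (AMP.monoCoef (D N)) (AMP.monoDeg (D N)) (fun _ _ => 1) (t N) m i) ∧
          (∀ R : ℝ, ∀ᶠ N : ℕ in atTop, ∀ i : Fin N,
            R ≤ |(∫ g, AMP.iterate (AMP.symMatrix N g) (AMP.monoPoly (D N))
                    (fun _ => 1) (t N) i ^ m ∂(AMP.gaussianLaw N)) -
                AMP.seMoment (AMP.monoPoly (D N)) 1 (t N) m|) := by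
  refine ⟨fun N D hD => ⟨AMP.isInstance_gaussian N hD, AMP.seVar_monoPoly D,
    AMP.uniformlyBounded_monoPoly D⟩, 48, by norm_num, 1 / 24, by norm_num, ?_⟩
  intro K D t hD ht hC hK m hm he
  have hlog : Tendsto (fun N => Real.log (D N)) atTop atTop :=
    Real.tendsto_log_atTop.comp (tendsto_natCast_atTop_atTop.comp hD)
  have hsize := AMP.eventually_four_mul_add_two_le hD hK
  -- the exponents in the lower bounds tend to infinity
  have hexp : ∀ R : ℝ, ∀ k : ℕ, 1 ≤ k → ∀ᶠ N : ℕ in atTop,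
      R ≤ Real.exp (1 / 24 * (2 * k : ℕ) * (D N : ℝ) ^ (t N - 1) * t N * Real.log (D N)) := by
    intro R k hk
    filter_upwards [ht, hlog.eventually_ge_atTop (4 * |R|), hD.eventually_ge_atTop 1]
      with N h1 h2 h3
    have h1' : (3 : ℝ) ≤ t N := by exact_mod_cast h1
    have hk' : (2 : ℝ) ≤ ((2 * k : ℕ) : ℝ) := by exact_mod_cast (by omega : 2 ≤ 2 * k)
    have hE : (1 : ℝ) ≤ (D N : ℝ) ^ (t N - 1) := one_le_pow₀ (by exact_mod_cast h3)
    have hl : 0 ≤ Real.log (D N) := le_trans (by positivity) h2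
    have h4 : 1 / 24 * 2 * 1 * 3 * Real.log (D N) ≤
        1 / 24 * (2 * k : ℕ) * (D N : ℝ) ^ (t N - 1) * t N * Real.log (D N) := by
      gcongr
    have h5 := Real.add_one_le_exp
      (1 / 24 * (2 * k : ℕ) * (D N : ℝ) ^ (t N - 1) * t N * Real.log (D N))
    linarith [le_abs_self R]
  have htree : ∀ᶠ N : ℕ in atTop, ∀ i : Fin N,
      Real.exp (1 / 24 * m * (D N : ℝ) ^ (t N - 1) * t N * Real.log (D N)) ≤
        AMP.treeContribution (AMP.gaussianLaw N) (AMP.symMatrix N)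
          (AMP.monoCoef (D N)) (AMP.monoDeg (D N)) (fun _ _ => 1) (t N) m i := by
    obtain ⟨k, rfl⟩ := he.two_dvd
    filter_upwards [ht, hC, hsize, hlog.eventually_ge_atTop 24] with N h1 h2 h3 h4 i
    have h3' : (4 * t N + 2 : ℝ) ≤ N := by exact_mod_cast h3
    exact (AMP.exp_le_moment_lower_bound (by omega) h1 (by omega) h4 (by linarith) h2).trans
      (AMP.le_treeContribution (by omega) (by omega) i)
  refine ⟨htree, fun R => ?_, fun R => ?_⟩
  · obtain ⟨k, rfl⟩ := he.two_dvd
    filter_upwards [htree, hexp R k (by omega)] with N h1 h2 i using h2.trans (h1 i)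
  · -- the `m`-th moment dominates the second one, whose lower bound is the case `k = 1`
    filter_upwards [ht, hC, hsize, hlog.eventually_ge_atTop 24, hD.eventually_ge_atTop 2,
      hexp (R + 1 + ∫ y, y ^ m ∂(gaussianReal 0 1)) 1 le_rfl] with N h1 h2 h3 h4 h5 h6 i
    have h3' : (4 * t N + 2 : ℝ) ≤ N := by exact_mod_cast h3
    have h7 := (AMP.exp_le_moment_lower_bound le_rfl h1 (by omega) h4
      (by linarith : (N : ℝ) / 2 ≤ N - 2 * t N - 1) h2).trans (by
        simpa only [one_mul] using
          AMP.le_integral_iterate_sq h5 (by omega : 2 ≤ t N) (by omega) i)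
    have hmom : HasAllMoments (AMP.gaussianLaw N) fun g =>
        AMP.iterate (AMP.symMatrix N g) (AMP.monoPoly (D N)) (fun _ => 1) (t N) i :=
      AMP.hasAllMoments_iterate AMP.hasAllMoments_symMatrix_apply _
        (fun _ => HasAllMoments.const 1) _ _
    have h8 : ∫ g, AMP.iterate (AMP.symMatrix N g) (AMP.monoPoly (D N)) (fun _ => 1) (t N) i ^ 2
        ∂(AMP.gaussianLaw N) ≤ 1 + ∫ g, AMP.iterate (AMP.symMatrix N g) (AMP.monoPoly (D N))
          (fun _ => 1) (t N) i ^ m ∂(AMP.gaussianLaw N) := by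
      have h9 := integral_mono (hmom.pow 2).integrable
        ((integrable_const (1 : ℝ)).add (hmom.pow m).integrable)
        fun g => AMP.sq_le_one_add_pow hm he _
      simp only [Pi.add_apply] at h9
      rw [integral_add (integrable_const _) (hmom.pow m).integrable] at h9
      simpa using h9
    rw [AMP.seMoment_monoPoly]
    exact le_trans (by linarith) (le_abs_self _)
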